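/- Let $\alpha\in\{1,-1\}$, let $V:\mathbb R\to\mathbb R$ be $C^\infty$ and $2\pi$-periodic, with Fourier coefficients $c_k=\frac1{2\pi}\int_0^{2\pi}V(x)e^{-ikx}\,dx$, and let $\omega\in\mathbb R$. For $\ell\in\mathbb Z$ let $A_{\alpha,\ell}(t)$ be the matrix indexed by $\mathbb Z\times\mathbb Z$ which acts on sequences by $(A_{\alpha,\ell}(t)\psi)_k=c_\ell\,e^{i\alpha\ell(2k-\ell)t}\,\psi_{k-\ell}$, and, for $M\in\mathbb N$, put (integrals taken entry by entry) $$A_\alpha^\omega(t)=\sum_{\ell\in\mathbb Z}e^{2i\omega\ell t}A_{\alpha,\ell}(t),\qquad B_\alpha^{\omega,M}(t)=\int_0^t\sum_{\ell=-M}^{M}e^{2i\omega\ell\tau}A_{\alpha,\ell}(\tau)\,d\tau .$$ Write $\delta_0=(\delta_0(\kappa))_{\kappa\in\mathbb Z}$ for the sequence equal to $1$ at $\kappa=0$ and $0$ elsewhere, and $\exp(P)=\sum_{n\ge0}P^n/n!$ for an infinite matrix $P$ (entry by entry). For $(t,x)\in\mathbb R^+\times\mathbb R$, $\mathbb R^+=[0,\infty)$,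 and $K,M,N\in\mathbb N$, let $$\phi^{\alpha,\omega}(t,x)=\sum_{k\in\mathbb Z}e^{-i\alpha k^2t}\Big(\exp\Big(\int_0^tA_\alpha^\omega(\tau)\,d\tau\Big)\delta_0\Big)_k e^{-i\omega^2t}e^{-2i\omega t}e^{i(k+\omega)x},$$ $$\phi^{\alpha,\omega}_{K,M,N}(t,x)=\sum_{k=-K}^{K}e^{-i\alpha k^2t}\Big(\Big(\mathrm{Id}+\sum_{n=1}^{N}\frac{(B_\alpha^{\omega,M}(t))^n}{n!}\Big)\delta_0\Big)_k e^{-i\omega^2t}e^{-2i\omega t}e^{i(k+\omega)x}.$$ For each $t\ge 0$ all the series in these formulas converge absolutely. The functions are locally integrable on $\mathbb R^+\times\mathbb R$, and are identified with the distributions $g\mapsto\int_{t\ge0}\int_{\mathbb R}\phi\,g\,dx\,dt$ on $\mathbb R_t\times\mathbb R_x$, supported in $\mathbb R^+\times\mathbb R$. These belong to the space $\mathscr S'_x(\mathbb R^+\times\mathbb R,\mathbb C)$ of distributions tempered with respect to $x$, that is, transported to $\mathbb R^+\times(\mathbb S^1\setminus\{(0,1)\})$ by stereographic projection in the variable $x$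 they extend to distributions on $\mathbb R^+\times\mathbb S^1$. Moreover: 1. As $K,M,N\to\infty$ (jointly), $\phi^{\alpha,\omega}_{K,M,N}\to\phi^{\alpha,\omega}$ in $\mathscr S'_x(\mathbb R^+\times\mathbb R,\mathbb C)$: one has convergence against every smooth $g(t,x)$ on $\mathbb R\times\mathbb R$ with bounded support in $t$ that is a Schwartz function on $\mathbb R\times\mathbb R$, and there are extensions of the $\phi^{\alpha,\omega}_{K,M,N}$ and of $\phi^{\alpha,\omega}$ to $\mathbb R^+\times\mathbb S^1$ for which the convergence holds in the sense of distributions on $\mathbb R^+\times\mathbb S^1$. 2. For all fixed $K,M,N\in\mathbb N$, $$\lim_{N'\to\infty}\sum_{\nu=0}^{N'}\binom{N'}{\nu}\Big(\frac{1+\omega}2\Big)^{N'-\nu}\Big(\frac{1-\omega}2\Big)^{\nu}\phi^{\alpha,\,1-2\nu/N'}_{K,M,N}=\phi^{\alpha,\omega}_{K,M,N}\quad\text{in }\mathscr D'(\mathbb R^+\times\mathbb R,\mathbb C).$$ -/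

import Mathlib

open Filter Topology MeasureTheory
open scoped Distributions SchwartzMap

namespace PeriodicSchrodinger

noncomputable section

/-! ### The potential and the infinite matrices -/

/-- The Fourier coefficient `c_k` of a `2π`-periodic function `V`, so that
`V x = ∑ k, c_k e^{ikx}`. -/
def potCoeff (V : ℝ → ℝ) (k : ℤ) : ℂ :=
  (1 / (2 * Real.pi) : ℂ) *
    ∫ x in (0 : ℝ)..(2 * Real.pi), (V x : ℂ) * Complex.exp (-(Complex.I * (k : ℂ) * (x : ℂ)))

/-- The matrix `A_{α,ℓ}(τ)` indexed by `ℤ × ℤ`: it acts on a sequence `ψ` by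
`(A_{α,ℓ}(τ) ψ)_k = c_ℓ e^{iαℓ(2k-ℓ)τ} ψ_{k-ℓ}`. -/
def modeMatrix (V : ℝ → ℝ) (α : ℝ) (l : ℤ) (τ : ℝ) : Matrix ℤ ℤ ℂ := fun k j =>
  if j = k - l then
    potCoeff V l * Complex.exp (Complex.I * (α : ℂ) * (l : ℂ) * (2 * (k : ℂ) - (l : ℂ)) * (τ : ℂ))
  else 0

/-- The full matrix `A_α^ω(τ) = ∑_{ℓ ∈ ℤ} e^{2iωℓτ} A_{α,ℓ}(τ)`, entry by entry (at each entry
only one term of the sum is non-zero). -/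
def fullMatrix (V : ℝ → ℝ) (α ω τ : ℝ) : Matrix ℤ ℤ ℂ := fun k j =>
  ∑' l : ℤ, Complex.exp (2 * Complex.I * (ω : ℂ) * (l : ℂ) * (τ : ℂ)) * modeMatrix V α l τ k j

/-- `∫_0^t A_α^ω(τ) dτ`, entry by entry. -/
def intFullMatrix (V : ℝ → ℝ) (α ω t : ℝ) : Matrix ℤ ℤ ℂ := fun k j =>
  ∫ τ in (0 : ℝ)..t, fullMatrix V α ω τ k j

/-- `B_α^{ω,M}(t) = ∫_0^t ∑_{|ℓ| ≤ M} e^{2iωℓτ} A_{α,ℓ}(τ) dτ`, entry by entry. -/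
def truncB (V : ℝ → ℝ) (α ω : ℝ) (M : ℕ) (t : ℝ) : Matrix ℤ ℤ ℂ := fun k j =>
  ∫ τ in (0 : ℝ)..t, ∑ l ∈ Finset.Icc (-(M : ℤ)) (M : ℤ),
    Complex.exp (2 * Complex.I * (ω : ℂ) * (l : ℂ) * (τ : ℂ)) * modeMatrix V α l τ k j

/-- Product of two infinite matrices. -/
def infMul (P Q : Matrix ℤ ℤ ℂ) : Matrix ℤ ℤ ℂ := fun k j => ∑' m : ℤ, P k m * Q m j

/-- Powers `P × ⋯ × P` of an infinite matrix, `P ^ 0` being the identity. -/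
def infPow (P : Matrix ℤ ℤ ℂ) : ℕ → Matrix ℤ ℤ ℂ
  | 0 => 1
  | n + 1 => infMul P (infPow P n)

/-- The exponential `∑_{n ≥ 0} P^n / n!` of an infinite matrix, entry by entry. -/
def infExp (P : Matrix ℤ ℤ ℂ) : Matrix ℤ ℤ ℂ := fun k j =>
  ∑' n : ℕ, infPow P n k j / (n.factorial : ℂ)

/-- The truncated exponential series `Id + ∑_{n=1}^N P^n / n!`. -/
def infExpTrunc (N : ℕ) (P : Matrix ℤ ℤ ℂ) : Matrix ℤ ℤ ℂ := fun k j =>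
  (1 : Matrix ℤ ℤ ℂ) k j + ∑ n ∈ Finset.Icc 1 N, infPow P n k j / (n.factorial : ℂ)

/-- Action of an infinite matrix on a sequence. -/
def infMulVec (P : Matrix ℤ ℤ ℂ) (v : ℤ → ℂ) : ℤ → ℂ := fun k => ∑' j : ℤ, P k j * v j

/-- The sequence `(δ_0(κ))_κ`. -/
def delta0 : ℤ → ℂ := Pi.single 0 1

/-- For infinite matrices indexed by `ℤ`: all the series which define the powers of `P`, the
exponential of `P` and the `ℓ¹` norm of the column `exp(P) δ_0` converge (absolutely). -/
def ExpConverges (P : Matrix ℤ ℤ ℂ) : Prop :=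
  (∀ (n : ℕ) (k j : ℤ), Summable fun m : ℤ => ‖P k m * infPow P n m j‖) ∧
  (∀ k j : ℤ, Summable fun n : ℕ => ‖infPow P n k j / (n.factorial : ℂ)‖) ∧
  Summable fun k : ℤ => ‖infMulVec (infExp P) delta0 k‖

/-! ### The function `φ^{α,ω}` and its truncations -/

/-- The factor
`e^{-iαk²t} e^{-iω²t} e^{-2iωt} e^{i(k+ω)x}`. -/
def wave (α ω : ℝ) (k : ℤ) (t x : ℝ) : ℂ :=
  Complex.exp (-(Complex.I * (α : ℂ) * (k : ℂ) ^ 2 * (t : ℂ))) *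
    Complex.exp (-(Complex.I * (ω : ℂ) ^ 2 * (t : ℂ))) *
    Complex.exp (-(2 * Complex.I * (ω : ℂ) * (t : ℂ))) *
    Complex.exp (Complex.I * ((k : ℂ) + (ω : ℂ)) * (x : ℂ))

/-- `φ^{α,ω}(t,x) = ∑_k e^{-iαk²t} (exp(∫_0^t A_α^ω) δ_0)_k e^{-iω²t} e^{-2iωt} e^{i(k+ω)x}`. -/
def phi (V : ℝ → ℝ) (α ω : ℝ) (p : ℝ × ℝ) : ℂ :=
  ∑' k : ℤ, infMulVec (infExp (intFullMatrix V α ω p.1)) delta0 k * wave α ω k p.1 p.2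

/-- The truncation `φ_{K,M,N}^{α,ω}`: Fourier modes `|k| ≤ K`, modes `|ℓ| ≤ M` of the potential,
terms of degree at most `N` of the exponential series. -/
def phiTrunc (V : ℝ → ℝ) (α : ℝ) (K M N : ℕ) (ω : ℝ) (p : ℝ × ℝ) : ℂ :=
  ∑ k ∈ Finset.Icc (-(K : ℤ)) (K : ℤ),
    infMulVec (infExpTrunc N (truncB V α ω M p.1)) delta0 k * wave α ω k p.1 p.2

/-! ### Distributions on `ℝ × ℝ` supported in `ℝ⁺ × ℝ` -/

/-- Lebesgue measure on the closed half-plane `{(t,x) | t ≥ 0}`. -/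
def halfMeasure : Measure (ℝ × ℝ) := (volume : Measure (ℝ × ℝ)).restrict {p | 0 ≤ p.1}

/-- The distribution `g ↦ ∫_{t ≥ 0} ∫_ℝ f(t,x) g(t,x) dx dt` on `ℝ × ℝ`, for a function `f`
which is locally integrable on the closed half-plane. -/
def halfDist (f : ℝ × ℝ → ℂ) : 𝓓'((⊤ : TopologicalSpace.Opens (ℝ × ℝ)), ℂ) :=
  (TestFunction.integralAgainstBilinCLM
    (ContinuousLinearMap.lsmul ℝ ℝ : ℝ →L[ℝ] ℂ →L[ℝ] ℂ) halfMeasure f :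
      𝓓((⊤ : TopologicalSpace.Opens (ℝ × ℝ)), ℝ) →L[ℝ] ℂ)

/-! ### Distributions on `ℝ⁺ × 𝕊¹` -/

/-- Test functions on `ℝ × 𝕊¹`, with `𝕊¹` described by an angle `θ` modulo `2π`: smooth functions
of `(t,θ)`, `2π`-periodic in `θ`, with bounded support in `t`. -/
def cylinderTest : Submodule ℝ (ℝ × ℝ → ℝ) where
  carrier := {g | ContDiff ℝ ((⊤ : ℕ∞) : WithTop ℕ∞) g ∧ (∀ t θ : ℝ, g (t, θ + 2 * Real.pi) = g (t, θ)) ∧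
    ∃ R : ℝ, ∀ t θ : ℝ, R < |t| → g (t, θ) = 0}
  add_mem' := by
    rintro f g ⟨hf, pf, Rf, sf⟩ ⟨hg, pg, Rg, sg⟩
    refine ⟨hf.add hg, fun t θ => ?_, max Rf Rg, fun t θ h => ?_⟩
    · simp [pf, pg]
    · simp [sf t θ (lt_of_le_of_lt (le_max_left _ _) h),
        sg t θ (lt_of_le_of_lt (le_max_right _ _) h)]
  zero_mem' := ⟨contDiff_const, fun _ _ => rfl, 0, fun _ _ _ => rfl⟩
  smul_mem' := by
    rintro c g ⟨hg, pg, R, sg⟩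
    refine ⟨hg.const_smul c, fun t θ => ?_, R, fun t θ h => ?_⟩
    · simp [pg]
    · simp [sg t θ h]

/-- Complex-valued distributions on `ℝ × 𝕊¹` with support in `ℝ⁺ × 𝕊¹`, as linear forms on real
test functions. Continuity: on the test functions supported in `|t| ≤ R`, the form is bounded by
finitely many derivatives. -/
structure CylinderDistribution where
  toLin : cylinderTest →ₗ[ℝ] ℂ
  bound : ∀ R : ℝ, ∃ (m : ℕ) (C : ℝ), ∀ g : cylinderTest,
    (∀ t θ : ℝ, R < |t| → (g : ℝ × ℝ → ℝ) (t, θ) = 0) →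
    ∀ b : ℝ, (∀ j ≤ m, ∀ p, ‖iteratedFDeriv ℝ j (g : ℝ × ℝ → ℝ) p‖ ≤ b) → ‖toLin g‖ ≤ C * b
  support : ∀ g : cylinderTest,
    (∃ ε > 0, ∀ t θ : ℝ, -ε < t → (g : ℝ × ℝ → ℝ) (t, θ) = 0) → toLin g = 0

/-- `Φ` extends `T` through the stereographic projection from `(0,1)`. The point
`w = (sin θ, -cos θ)` of the circle, `θ ∈ (-π, π)`, is projected to
`x = sin θ / (1 + cos θ) = tan (θ / 2)`, so that `θ = 2 arctan x`, and the pole `(0,1)` is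
`θ = π`. The test functions on `ℝ × (𝕊¹ ∖ {(0,1)})` are those `g` for which
`(t, x) ↦ g (t, 2 arctan x)` is a (compactly supported) test function on `ℝ × ℝ`. -/
def CylinderDistribution.Extends (Φ : CylinderDistribution)
    (T : 𝓓'((⊤ : TopologicalSpace.Opens (ℝ × ℝ)), ℂ)) : Prop :=
  ∀ (g : cylinderTest) (f : 𝓓((⊤ : TopologicalSpace.Opens (ℝ × ℝ)), ℝ)),
    (∀ t x : ℝ, f (t, x) = (g : ℝ × ℝ → ℝ) (t, 2 * Real.arctan x)) → Φ.toLin g = T f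

/-- A distribution on `ℝ⁺ × ℝ` is tempered with respect to `x` if, transported by the
stereographic projection, it extends to a distribution on `ℝ⁺ × 𝕊¹`. -/
def IsTemperedInX (T : 𝓓'((⊤ : TopologicalSpace.Opens (ℝ × ℝ)), ℂ)) : Prop :=
  ∃ Φ : CylinderDistribution, Φ.Extends T

/-- Convergence of distributions on `ℝ⁺ × ℝ`, tempered with respect to `x`, when considered as
distributions on `ℝ⁺ × 𝕊¹`: they have extensions which converge against each test function on
`ℝ × 𝕊¹`. -/
def TendstoOnCylinder {ι : Type*} (T : ι → 𝓓'((⊤ : TopologicalSpace.Opens (ℝ × ℝ)), ℂ))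
    (l : Filter ι) (S : 𝓓'((⊤ : TopologicalSpace.Opens (ℝ × ℝ)), ℂ)) : Prop :=
  ∃ (Φ : ι → CylinderDistribution) (Ψ : CylinderDistribution),
    (∀ i, (Φ i).Extends (T i)) ∧ Ψ.Extends S ∧
    ∀ g : cylinderTest, Tendsto (fun i => (Φ i).toLin g) l (𝓝 (Ψ.toLin g))

/-- Test functions which are compactly supported in `t` and Schwartz in `x`: the Schwartz
functions on `ℝ × ℝ` with bounded support in `t`. -/
def HasBoundedTimeSupport (g : 𝓢(ℝ × ℝ, ℂ)) : Prop :=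
  ∃ R : ℝ, ∀ t x : ℝ, R < |t| → g (t, x) = 0

end

end PeriodicSchrodinger

open PeriodicSchrodinger

/-!
# Approximation of the Schrödinger evolution by truncations, and the supershift

Everything rests on three estimates.

*Domination.* The entries of `∫_0^t A_α^ω` and of `B_α^{ω,M}(t)` at `(k, j)` are bounded by
`|t| |c_{k-j}|`, and `∑ |c_k| < ∞` since `V` is smooth (`summable_norm_potCoeff`). So the entries of
the `n`-th powers are bounded by a convolution power (`norm_infPow_le`), and the double series over
the mode `k` and the degree `n` are dominated, uniformly in `K, M, N`, by a series with sum
`e^{|t| ∑ |c_k|}` (`hasSum_convPow_div_factorial`). Dominated convergence gives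
`φ_{K,M,N} → φ` pointwise, with the bound `e^{|t| ∑ |c_k|}` for all these functions; a second
dominated convergence gives the convergence against Schwartz functions.

*Extension to the cylinder.* A function bounded in `x` is not integrable against a test function of
the circle, which is only bounded in the stereographic coordinate. Subtracting from the test
function its first-order Taylor polynomial at the pole leaves `O(x⁻²)` (`abs_poleReg_le`), and
changes nothing if the test function vanishes near the pole. The integral against this difference
defines an extension (`cylExtension`), continuous for the `C²` norms, and the same dominated
convergence applies to it.

*Supershift.* With `y = (1 + s) / 2`, the superposition of the frequencies `s = 1 - 2ν/N'` is the
`N'`-th Bernstein operator in `y`, evaluated at the point `(1 + ω) / 2`, which may lie outside of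
`[0, 1]`. The truncation `φ_{K,M,N}^{α,s}(t,x)` is an entire function of `s`, because `B_α^{s,M}` has
only finitely many nonzero diagonals. On the monomial `y^m` the operator is bounded at a real `x` by
`max(1, |x|)^m` and converges to `x^m`, by a recursion for the moments of the Bernstein weights
(`bernsteinMoment_succ_succ`); Cauchy's estimates for the Taylor coefficients turn this into
convergence on entire functions, with a rate times the maximum on a fixed circle
(`exists_bernstein_error`). That maximum is a continuous function `W` of `(t, x)`, and
`u ↦ ∫ |W u|` is a continuous seminorm on test functions, so the convergence is uniform on compact
sets of test functions, which is the topology of `𝓓'`.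
-/

namespace PeriodicSchrodinger

/-! ### Fourier coefficients of a smooth periodic potential -/

theorem potCoeff_deriv {V : ℝ → ℝ} (hV : ContDiff ℝ 1 V)
    (hper : Function.Periodic V (2 * Real.pi)) (k : ℤ) :
    potCoeff (deriv V) k = Complex.I * k * potCoeff V k := by
  have hpi : (Real.pi : ℂ) ≠ 0 := by exact_mod_cast Real.pi_ne_zero
  have hd : ∀ x : ℝ, HasDerivAt (fun x : ℝ => (V x : ℂ)) ((deriv V x : ℝ) : ℂ) x := fun x =>
    ((hV.differentiable one_ne_zero).differentiableAt.hasDerivAt (x := x)).ofReal_comp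
  have he : ∀ x : ℝ, HasDerivAt (fun x : ℝ => Complex.exp (-(Complex.I * (k : ℂ) * (x : ℂ))))
      (-(Complex.I * k) * Complex.exp (-(Complex.I * (k : ℂ) * (x : ℂ)))) x := fun x => by
    have h1 : HasDerivAt (fun x : ℝ => -(Complex.I * (k : ℂ) * (x : ℂ))) (-(Complex.I * k)) x := by
      simpa using ((Complex.ofRealCLM.hasDerivAt (x := x)).const_mul (Complex.I * (k : ℂ))).fun_neg
    simpa [mul_comm] using h1.cexp
  have hc : Continuous (deriv V) := hV.continuous_deriv le_rfl
  have key := intervalIntegral.integral_mul_deriv_eq_deriv_mul (a := 0) (b := 2 * Real.pi)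
    (fun x _ => hd x) (fun x _ => he x)
    ((Complex.continuous_ofReal.comp hc).intervalIntegrable _ _)
    (Continuous.intervalIntegrable (by fun_prop) _ _)
  have hVper : V (2 * Real.pi) = V 0 := by simpa using hper 0
  have hexp : Complex.exp (-(Complex.I * (k : ℂ) * ((2 * Real.pi : ℝ) : ℂ))) = 1 := by
    rw [Complex.exp_eq_one_iff]
    exact ⟨-k, by push_cast; ring⟩
  rw [hexp, hVper] at key
  simp only [Complex.ofReal_zero, mul_zero, neg_zero, Complex.exp_zero, mul_one, sub_self,
    zero_sub] at key
  have key2 : (∫ x in (0 : ℝ)..(2 * Real.pi), ((deriv V x : ℝ) : ℂ) *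
      Complex.exp (-(Complex.I * (k : ℂ) * (x : ℂ)))) = Complex.I * k *
      ∫ x in (0 : ℝ)..(2 * Real.pi), (V x : ℂ) *
        Complex.exp (-(Complex.I * (k : ℂ) * (x : ℂ))) := by
    rw [← neg_eq_iff_eq_neg.mpr key, ← intervalIntegral.integral_const_mul,
      ← intervalIntegral.integral_neg]
    congr 1; ext x; ring
  rw [potCoeff, potCoeff, key2]; ring

theorem norm_exp_I_real (a : ℂ) (h : a.im = 0) : ‖Complex.exp (Complex.I * a)‖ = 1 := by
  rw [Complex.norm_exp]; simp [h]

theorem exists_norm_potCoeff_le (V : ℝ → ℝ) :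
    ∃ C, ∀ k, ‖potCoeff V k‖ ≤ C := by
  refine ⟨‖(1 / (2 * Real.pi) : ℂ)‖ * ∫ x in (0 : ℝ)..(2 * Real.pi), ‖V x‖, fun k => ?_⟩
  rw [potCoeff, norm_mul]
  gcongr
  refine (intervalIntegral.norm_integral_le_integral_norm (by positivity)).trans_eq ?_
  congr 1; ext x
  have : ‖Complex.exp (-(Complex.I * (k : ℂ) * (x : ℂ)))‖ = 1 := by
    rw [mul_assoc, ← mul_neg]; exact norm_exp_I_real _ (by simp)
  rw [norm_mul, this, Complex.norm_real, mul_one]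

/-- Two integrations by parts give `c_k = O(k⁻²)`. -/
theorem summable_norm_potCoeff {V : ℝ → ℝ} (hV : ContDiff ℝ 2 V)
    (hper : Function.Periodic V (2 * Real.pi)) : Summable fun k => ‖potCoeff V k‖ := by
  have hV' : ContDiff ℝ 1 (deriv V) := by
    have : ContDiff ℝ (1 + 1) V := by simpa [one_add_one_eq_two] using hV
    exact (contDiff_succ_iff_deriv.mp this).2.2
  obtain ⟨C, hC⟩ := exists_norm_potCoeff_le (deriv (deriv V))
  have hper' : Function.Periodic (deriv V) (2 * Real.pi) := fun x => by
    rw [← deriv_comp_add_const]; congr 1; ext y; exact hper y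
  refine Summable.of_norm_bounded_eventually (g := fun k : ℤ => C * (1 / (k : ℝ) ^ 2))
    ((Real.summable_one_div_int_pow.mpr one_lt_two).mul_left C) ?_
  have : ∀ᶠ k : ℤ in cofinite, k ≠ 0 := (Set.finite_singleton 0).compl_mem_cofinite
  filter_upwards [this] with k hk
  have h := hC k
  rw [potCoeff_deriv hV' hper', potCoeff_deriv (hV.of_le one_le_two) hper] at h
  have hk' : (0 : ℝ) < |(k : ℝ)| := by positivity
  simp only [norm_mul, Complex.norm_I, one_mul, Complex.norm_intCast] at h
  rw [norm_norm, mul_one_div, le_div_iff₀ (by positivity), ← sq_abs]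
  linarith

/-! ### The entries of the matrices -/

noncomputable section

/-- The matrix `∫_0^t A_α^z` for a complex frequency `z`. -/
def freqMatrix (V : ℝ → ℝ) (α : ℝ) (z : ℂ) (t : ℝ) : Matrix ℤ ℤ ℂ := fun k j =>
  potCoeff V (k - j) *
    ∫ τ in (0 : ℝ)..t, Complex.exp (Complex.I * ((2 * z + α * (k + j)) * (k - j) * τ))

/-- The matrix `B_α^{z,M}(t)` for a complex frequency `z`: the diagonals `|k - j| ≤ M` of
`freqMatrix`. -/
def bandMatrix (V : ℝ → ℝ) (α : ℝ) (M : ℕ) (z : ℂ) (t : ℝ) : Matrix ℤ ℤ ℂ := fun k j =>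
  if k - j ∈ Finset.Icc (-(M : ℤ)) (M : ℤ) then freqMatrix V α z t k j else 0

end

theorem modeMatrix_sub_apply (V : ℝ → ℝ) (α ω τ : ℝ) (k j : ℤ) :
    Complex.exp (2 * Complex.I * (ω : ℂ) * ((k - j : ℤ) : ℂ) * (τ : ℂ)) *
      modeMatrix V α (k - j) τ k j = potCoeff V (k - j) *
        Complex.exp (Complex.I * ((2 * ω + α * (k + j)) * (k - j) * τ)) := by
  rw [modeMatrix, if_pos (by ring), mul_left_comm, ← Complex.exp_add]
  congr 2; push_cast; ring

theorem modeMatrix_of_ne (V : ℝ → ℝ) (α τ : ℝ) {k j l : ℤ} (h : l ≠ k - j) :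
    modeMatrix V α l τ k j = 0 :=
  if_neg fun h' => h (by omega)

theorem intFullMatrix_eq (V : ℝ → ℝ) (α ω t : ℝ) :
    intFullMatrix V α ω t = freqMatrix V α ω t := by
  ext k j
  rw [intFullMatrix, freqMatrix, ← intervalIntegral.integral_const_mul]
  congr 1; ext τ
  rw [fullMatrix, tsum_eq_single (k - j) fun l hl => by rw [modeMatrix_of_ne V α τ hl, mul_zero],
    modeMatrix_sub_apply]

theorem truncB_eq (V : ℝ → ℝ) (α ω : ℝ) (M : ℕ) (t : ℝ) :
    truncB V α ω M t = bandMatrix V α M ω t := by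
  ext k j
  rw [truncB, bandMatrix]
  split_ifs with h
  · rw [freqMatrix, ← intervalIntegral.integral_const_mul]
    congr 1; ext τ
    rw [Finset.sum_eq_single_of_mem (k - j) h fun l _ hl => by
      rw [modeMatrix_of_ne V α τ hl, mul_zero], modeMatrix_sub_apply]
  · have : ∀ τ : ℝ, ∑ l ∈ Finset.Icc (-(M : ℤ)) (M : ℤ),
        Complex.exp (2 * Complex.I * (ω : ℂ) * (l : ℂ) * (τ : ℂ)) * modeMatrix V α l τ k j = 0 :=
      fun τ => Finset.sum_eq_zero fun l hl => by
        rw [modeMatrix_of_ne V α τ (fun h' => h (h' ▸ hl)), mul_zero]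
    simp [this]

theorem norm_freqMatrix_le (V : ℝ → ℝ) (α ω t : ℝ) (k j : ℤ) :
    ‖freqMatrix V α ω t k j‖ ≤ |t| * ‖potCoeff V (k - j)‖ := by
  rw [freqMatrix, norm_mul, mul_comm]
  gcongr
  have h := intervalIntegral.norm_integral_le_of_norm_le_const (a := 0) (b := t) (C := 1)
    (f := fun τ : ℝ => Complex.exp (Complex.I * ((2 * ω + α * (k + j)) * (k - j) * τ)))
    (fun τ _ => (norm_exp_I_real _ (by simp)).le)
  simpa using h

theorem norm_bandMatrix_le (V : ℝ → ℝ) (α : ℝ) (M : ℕ) (ω t : ℝ) (k j : ℤ) :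
    ‖bandMatrix V α M ω t k j‖ ≤ |t| * ‖potCoeff V (k - j)‖ := by
  rw [bandMatrix]
  split_ifs
  · exact norm_freqMatrix_le V α ω t k j
  · rw [norm_zero]; positivity

theorem tendsto_bandMatrix (V : ℝ → ℝ) (α : ℝ) (z : ℂ) (t : ℝ) (k j : ℤ) :
    Tendsto (fun M => bandMatrix V α M z t k j) atTop (𝓝 (freqMatrix V α z t k j)) := by
  refine tendsto_const_nhds.congr' ?_
  filter_upwards [eventually_ge_atTop (k - j).natAbs] with M hM
  rw [bandMatrix, if_pos (by rw [Finset.mem_Icc]; omega)]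

/-! ### Infinite matrices dominated by a convolution -/

/-- The `n`-th convolution power of `b : ℤ → ℝ`. It dominates the `n`-th power of a matrix `P` with
`‖P k j‖ ≤ b (k - j)`. -/
noncomputable def convPow (b : ℤ → ℝ) : ℕ → ℤ → ℝ
  | 0 => Pi.single 0 1
  | n + 1 => fun k => ∑' m : ℤ, b (k - m) * convPow b n m

section

variable {b : ℤ → ℝ}

theorem hasSum_conv {c : ℤ → ℝ} {s t : ℝ} (hb0 : ∀ k, 0 ≤ b k) (hc0 : ∀ k, 0 ≤ c k)
    (hb : HasSum b s) (hc : HasSum c t) :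
    (∀ k, Summable fun m => b (k - m) * c m) ∧
      HasSum (fun k => ∑' m : ℤ, b (k - m) * c m) (s * t) := by
  have h1 : HasSum (fun q : ℤ × ℤ => b q.1 * c q.2) (s * t) :=
    hb.mul hc (hb.summable.mul_of_nonneg hc.summable hb0 hc0)
  let e : ℤ × ℤ ≃ ℤ × ℤ :=
    { toFun := fun q => (q.1 - q.2, q.2)
      invFun := fun q => (q.1 + q.2, q.2)
      left_inv := fun q => by simp
      right_inv := fun q => by simp }
  have h2 : HasSum (fun q : ℤ × ℤ => b (q.1 - q.2) * c q.2) (s * t) := e.hasSum_iff.mpr h1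
  have h3 : ∀ k, Summable fun m => b (k - m) * c m := fun k => h2.summable.prod_factor k
  exact ⟨h3, h2.prod_fiberwise fun k => (h3 k).hasSum⟩

theorem convPow_nonneg (hb0 : ∀ k, 0 ≤ b k) : ∀ n k, 0 ≤ convPow b n k
  | 0, k => by
    rw [convPow, Pi.single_apply]; split_ifs <;> simp
  | n + 1, k => tsum_nonneg fun m => mul_nonneg (hb0 _) (convPow_nonneg hb0 n m)

theorem hasSum_convPow (hb0 : ∀ k, 0 ≤ b k) (hb : Summable b) (n : ℕ) :
    HasSum (convPow b n) ((∑' k, b k) ^ n) := by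
  induction n with
  | zero =>
    have := hasSum_single (f := convPow b 0) (0 : ℤ) fun k hk => by simp [convPow, hk]
    simpa [convPow] using this
  | succ n ih =>
    rw [pow_succ']
    exact (hasSum_conv hb0 (convPow_nonneg hb0 n) hb.hasSum ih).2

theorem hasSum_convPow_succ (hb0 : ∀ k, 0 ≤ b k) (hb : Summable b) (n : ℕ) (k j : ℤ) :
    HasSum (fun m => b (k - m) * convPow b n (m - j)) (convPow b (n + 1) (k - j)) := by
  have h := ((hasSum_conv hb0 (convPow_nonneg hb0 n) hb.hasSum
    (hasSum_convPow hb0 hb n)).1 (k - j)).hasSum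
  refine ((Equiv.subRight j).hasSum_iff.mpr h).congr_fun ?_
  intro m
  simp

theorem norm_infPow_le (hb0 : ∀ k, 0 ≤ b k) (hb : Summable b) {P : Matrix ℤ ℤ ℂ}
    (hP : ∀ k j, ‖P k j‖ ≤ b (k - j)) (n : ℕ) (k j : ℤ) :
    ‖infPow P n k j‖ ≤ convPow b n (k - j) := by
  induction n generalizing k with
  | zero =>
    rw [infPow, convPow, Matrix.one_apply, Pi.single_apply]
    by_cases h : k = j
    · simp [h]
    · simp [h, sub_eq_zero]
  | succ n ih =>
    refine tsum_of_norm_bounded (hasSum_convPow_succ hb0 hb n k j) fun m => ?_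
    rw [norm_mul]
    exact mul_le_mul (hP k m) (ih m) (norm_nonneg _) (hb0 _)

theorem tendsto_infPow (hb0 : ∀ k, 0 ≤ b k) (hb : Summable b) {P : ℕ → Matrix ℤ ℤ ℂ}
    {Q : Matrix ℤ ℤ ℂ} (hP : ∀ M k j, ‖P M k j‖ ≤ b (k - j))
    (hQ : ∀ k j, Tendsto (fun M => P M k j) atTop (𝓝 (Q k j))) (n : ℕ) (k j : ℤ) :
    Tendsto (fun M => infPow (P M) n k j) atTop (𝓝 (infPow Q n k j)) := by
  induction n generalizing k with
  | zero => exact tendsto_const_nhds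
  | succ n ih =>
    refine tendsto_tsum_of_dominated_convergence (hasSum_convPow_succ hb0 hb n k j).summable
      (fun m => (hQ k m).mul (ih m)) (Eventually.of_forall fun M m => ?_)
    rw [norm_mul]
    exact mul_le_mul (hP M k m) (norm_infPow_le hb0 hb (hP M) n m j) (norm_nonneg _) (hb0 _)

/-- The sequence which dominates the double series `∑_{k,n} (P^n / n!)_{k,0}`. -/
theorem hasSum_convPow_div_factorial (hb0 : ∀ k, 0 ≤ b k) (hb : Summable b) :
    HasSum (fun q : ℤ × ℕ => convPow b q.2 q.1 / (q.2.factorial : ℝ))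
      (Real.exp (∑' k, b k)) := by
  have h1 : ∀ n : ℕ, HasSum (fun k => convPow b n k / (n.factorial : ℝ))
      ((∑' k, b k) ^ n / (n.factorial : ℝ)) := fun n => (hasSum_convPow hb0 hb n).div_const _
  have h2 : HasSum (fun n : ℕ => (∑' k, b k) ^ n / (n.factorial : ℝ)) (Real.exp (∑' k, b k)) := by
    rw [Real.exp_eq_exp_ℝ]
    exact NormedSpace.expSeries_div_hasSum_exp _
  have h3 : Summable fun q : ℕ × ℤ => convPow b q.1 q.2 / (q.1.factorial : ℝ) := by
    refine (summable_prod_of_nonneg fun q => ?_).mpr ⟨fun n => (h1 n).summable, ?_⟩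
    · exact div_nonneg (convPow_nonneg hb0 _ _) (Nat.cast_nonneg _)
    · exact h2.summable.congr fun n => (h1 n).tsum_eq.symm
  have h4 := h3.hasSum
  rw [h4.prod_fiberwise h1 |>.unique h2] at h4
  exact (Equiv.prodComm ℤ ℕ).hasSum_iff.mpr h4

theorem infMulVec_delta0 (P : Matrix ℤ ℤ ℂ) (k : ℤ) : infMulVec P delta0 k = P k 0 := by
  rw [infMulVec, tsum_eq_single 0 fun j hj => by simp [delta0, hj]]
  simp [delta0]

theorem infExpTrunc_eq_sum (N : ℕ) (P : Matrix ℤ ℤ ℂ) (k j : ℤ) :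
    infExpTrunc N P k j = ∑ n ∈ Finset.range (N + 1), infPow P n k j / (n.factorial : ℂ) := by
  rw [infExpTrunc]
  induction N with
  | zero => simp [infPow]
  | succ N ih =>
    rw [Finset.sum_range_succ, ← ih, Finset.sum_Icc_succ_top (by omega), add_assoc]

theorem norm_infPow_div_factorial_le (hb0 : ∀ k, 0 ≤ b k) (hb : Summable b) {P : Matrix ℤ ℤ ℂ}
    (hP : ∀ k j, ‖P k j‖ ≤ b (k - j)) (q : ℤ × ℕ) :
    ‖infPow P q.2 q.1 0 / (q.2.factorial : ℂ)‖ ≤ convPow b q.2 q.1 / (q.2.factorial : ℝ) := by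
  rw [norm_div, Complex.norm_natCast]
  gcongr
  simpa using norm_infPow_le hb0 hb hP q.2 q.1 0

theorem summable_infPow_div_factorial (hb0 : ∀ k, 0 ≤ b k) (hb : Summable b) {P : Matrix ℤ ℤ ℂ}
    (hP : ∀ k j, ‖P k j‖ ≤ b (k - j)) (k j : ℤ) :
    Summable fun n : ℕ => ‖infPow P n k j / (n.factorial : ℂ)‖ := by
  refine ((hasSum_convPow_div_factorial hb0 hb).summable.prod_factor (k - j)).of_nonneg_of_le
    (fun n => norm_nonneg _) fun n => ?_
  rw [norm_div, Complex.norm_natCast]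
  gcongr
  exact norm_infPow_le hb0 hb hP n k j

theorem expConverges_of_norm_le (hb0 : ∀ k, 0 ≤ b k) (hb : Summable b) {P : Matrix ℤ ℤ ℂ}
    (hP : ∀ k j, ‖P k j‖ ≤ b (k - j)) : ExpConverges P := by
  refine ⟨fun n k j => ?_, summable_infPow_div_factorial hb0 hb hP, ?_⟩
  · refine (hasSum_convPow_succ hb0 hb n k j).summable.of_nonneg_of_le
      (fun m => norm_nonneg _) fun m => ?_
    rw [norm_mul]
    exact mul_le_mul (hP k m) (norm_infPow_le hb0 hb hP n m j) (norm_nonneg _) (hb0 _)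
  · refine (hasSum_convPow_div_factorial hb0 hb).summable.prod.of_nonneg_of_le
      (fun k => norm_nonneg _) fun k => ?_
    rw [infMulVec_delta0]
    exact tsum_of_norm_bounded
      ((hasSum_convPow_div_factorial hb0 hb).summable.prod_factor k).hasSum
      fun n => norm_infPow_div_factorial_le hb0 hb hP (k, n)

end

/-! ### Domination and pointwise convergence of the truncations -/

theorem norm_wave (α ω : ℝ) (k : ℤ) (t x : ℝ) : ‖wave α ω k t x‖ = 1 := by
  have h : wave α ω k t x = Complex.exp (Complex.I * (-(α * k ^ 2 * t) - ω ^ 2 * t - 2 * ω * t +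
      (k + ω) * x)) := by
    rw [wave, ← Complex.exp_add, ← Complex.exp_add, ← Complex.exp_add]
    congr 1; ring
  rw [h]
  apply norm_exp_I_real
  have : (-(α * k ^ 2 * t) - ω ^ 2 * t - 2 * ω * t + (k + ω) * x : ℂ) =
      ((-(α * k ^ 2 * t) - ω ^ 2 * t - 2 * ω * t + (k + ω) * x : ℝ) : ℂ) := by push_cast; ring
  rw [this, Complex.ofReal_im]

theorem phi_eq_tsum {V : ℝ → ℝ} (hV : Summable fun k => ‖potCoeff V k‖) (α ω : ℝ) (p : ℝ × ℝ) :
    phi V α ω p = ∑' q : ℤ × ℕ, infPow (freqMatrix V α ω p.1) q.2 q.1 0 / (q.2.factorial : ℂ) *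
      wave α ω q.1 p.1 p.2 := by
  have hb0 : ∀ k, 0 ≤ |p.1| * ‖potCoeff V k‖ := fun k => by positivity
  have hs : Summable fun q : ℤ × ℕ =>
      infPow (freqMatrix V α ω p.1) q.2 q.1 0 / (q.2.factorial : ℂ) * wave α ω q.1 p.1 p.2 := by
    refine (hasSum_convPow_div_factorial hb0 (hV.mul_left _)).summable.of_norm_bounded fun q => ?_
    rw [norm_mul, norm_wave, mul_one]
    exact norm_infPow_div_factorial_le hb0 (hV.mul_left _) (norm_freqMatrix_le V α ω p.1) q
  rw [hs.tsum_prod, phi]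
  congr 1; ext k
  rw [infMulVec_delta0, intFullMatrix_eq]
  exact tsum_mul_right.symm

theorem phiTrunc_eq_tsum (V : ℝ → ℝ) (α : ℝ) (K M N : ℕ) (ω : ℝ) (p : ℝ × ℝ) :
    phiTrunc V α K M N ω p = ∑' q : ℤ × ℕ,
      if q.1 ∈ Finset.Icc (-(K : ℤ)) K ∧ q.2 ∈ Finset.range (N + 1) then
        infPow (bandMatrix V α M ω p.1) q.2 q.1 0 / (q.2.factorial : ℂ) * wave α ω q.1 p.1 p.2
      else 0 := by
  rw [tsum_eq_sum (s := Finset.Icc (-(K : ℤ)) K ×ˢ Finset.range (N + 1)) fun q hq => by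
    rw [Finset.mem_product] at hq; rw [if_neg hq], Finset.sum_product, phiTrunc]
  refine Finset.sum_congr rfl fun k hk => ?_
  rw [infMulVec_delta0, infExpTrunc_eq_sum, Finset.sum_mul, truncB_eq]
  exact Finset.sum_congr rfl fun n hn => by rw [if_pos ⟨hk, hn⟩]

theorem norm_phiTrunc_term_le {V : ℝ → ℝ} (hV : Summable fun k => ‖potCoeff V k‖) (α : ℝ)
    (K M N : ℕ) (ω : ℝ) (p : ℝ × ℝ) (q : ℤ × ℕ) :
    ‖(if q.1 ∈ Finset.Icc (-(K : ℤ)) K ∧ q.2 ∈ Finset.range (N + 1) then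
        infPow (bandMatrix V α M ω p.1) q.2 q.1 0 / (q.2.factorial : ℂ) * wave α ω q.1 p.1 p.2
      else 0)‖ ≤
      convPow (fun k => |p.1| * ‖potCoeff V k‖) q.2 q.1 / (q.2.factorial : ℝ) := by
  have hb0 : ∀ k, 0 ≤ |p.1| * ‖potCoeff V k‖ := fun k => by positivity
  split_ifs
  · rw [norm_mul, norm_wave, mul_one]
    exact norm_infPow_div_factorial_le hb0 (hV.mul_left _) (norm_bandMatrix_le V α M ω p.1) q
  · rw [norm_zero]
    exact div_nonneg (convPow_nonneg hb0 _ _) (Nat.cast_nonneg _)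

theorem norm_phiTrunc_le {V : ℝ → ℝ} (hV : Summable fun k => ‖potCoeff V k‖) (α : ℝ)
    (K M N : ℕ) (ω : ℝ) (p : ℝ × ℝ) :
    ‖phiTrunc V α K M N ω p‖ ≤ Real.exp (|p.1| * ∑' k, ‖potCoeff V k‖) := by
  rw [phiTrunc_eq_tsum, ← tsum_mul_left]
  exact tsum_of_norm_bounded
    (hasSum_convPow_div_factorial (fun k => by positivity) (hV.mul_left _))
    (norm_phiTrunc_term_le hV α K M N ω p)

/-- Dominated convergence for the double series over the mode `k` and the degree `n`. -/
theorem tendsto_phiTrunc {V : ℝ → ℝ} (hV : Summable fun k => ‖potCoeff V k‖) (α ω : ℝ)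
    (p : ℝ × ℝ) :
    Tendsto (fun i : ℕ × ℕ × ℕ => phiTrunc V α i.1 i.2.1 i.2.2 ω p)
      (atTop ×ˢ atTop ×ˢ atTop) (𝓝 (phi V α ω p)) := by
  have hb0 : ∀ k, 0 ≤ |p.1| * ‖potCoeff V k‖ := fun k => by positivity
  simp_rw [phiTrunc_eq_tsum, phi_eq_tsum hV]
  refine tendsto_tsum_of_dominated_convergence
    (hasSum_convPow_div_factorial hb0 (hV.mul_left _)).summable (fun q => ?_)
    (Eventually.of_forall fun i => norm_phiTrunc_term_le hV α i.1 i.2.1 i.2.2 ω p)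
  have hM : Tendsto (fun i : ℕ × ℕ × ℕ => i.2.1) (atTop ×ˢ atTop ×ˢ atTop) atTop :=
    tendsto_fst.comp tendsto_snd
  have hN : Tendsto (fun i : ℕ × ℕ × ℕ => i.2.2) (atTop ×ˢ atTop ×ˢ atTop) atTop :=
    tendsto_snd.comp tendsto_snd
  have hK : Tendsto (fun i : ℕ × ℕ × ℕ => i.1) (atTop ×ˢ atTop ×ˢ atTop) atTop := tendsto_fst
  have h1 := ((tendsto_infPow hb0 (hV.mul_left _)
    (fun M => norm_bandMatrix_le V α M ω p.1) (tendsto_bandMatrix V α ω p.1) q.2 q.1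
    0).div_const (q.2.factorial : ℂ)).mul_const (wave α ω q.1 p.1 p.2)
  refine (h1.comp hM).congr' ?_
  filter_upwards [hK.eventually_ge_atTop q.1.natAbs, hN.eventually_ge_atTop q.2] with i h2 h3
  rw [if_pos ⟨by rw [Finset.mem_Icc]; omega, by rw [Finset.mem_range]; omega⟩]
  rfl

theorem norm_phi_le {V : ℝ → ℝ} (hV : Summable fun k => ‖potCoeff V k‖) (α ω : ℝ) (p : ℝ × ℝ) :
    ‖phi V α ω p‖ ≤ Real.exp (|p.1| * ∑' k, ‖potCoeff V k‖) :=
  le_of_tendsto' (tendsto_phiTrunc hV α ω p).norm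
    fun i => norm_phiTrunc_le hV α i.1 i.2.1 i.2.2 ω p

/-! ### Analytic dependence of the truncations on the frequency -/

/-- A family of functions of a point `p`, continuous in `(z, p)` and entire in the frequency `z`. -/
def EntireFamily {X : Type*} [TopologicalSpace X] (f : ℂ → X → ℂ) : Prop :=
  Continuous (Function.uncurry f) ∧ ∀ p, Differentiable ℂ fun z => f z p

namespace EntireFamily

variable {X : Type*} [TopologicalSpace X] {f g : ℂ → X → ℂ}

theorem continuous_right (hf : EntireFamily f) (z : ℂ) : Continuous (f z) :=
  hf.1.comp (Continuous.prodMk_right z)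

theorem const (c : ℂ) : EntireFamily fun (_ : ℂ) (_ : X) => c :=
  ⟨continuous_const, fun _ => differentiable_const c⟩

theorem mul (hf : EntireFamily f) (hg : EntireFamily g) :
    EntireFamily fun z p => f z p * g z p :=
  ⟨hf.1.mul hg.1, fun p => (hf.2 p).mul (hg.2 p)⟩

theorem sum {ι : Type*} {s : Finset ι} {f : ι → ℂ → X → ℂ} (hf : ∀ i ∈ s, EntireFamily (f i)) :
    EntireFamily fun z p => ∑ i ∈ s, f i z p :=
  ⟨continuous_finsetSum s fun i hi => (hf i hi).1,
    fun p => Differentiable.fun_sum fun i hi => (hf i hi).2 p⟩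

end EntireFamily

theorem differentiable_dslope_exp : Differentiable ℂ (dslope Complex.exp 0) := by
  rw [← differentiableOn_univ, Complex.differentiableOn_dslope univ_mem]
  exact Complex.differentiable_exp.differentiableOn

/-- The divided difference of `exp` shows without a case distinction that the integral is entire in
`c`, also at `c = 0`. -/
theorem integral_cexp_eq_dslope (c : ℂ) (t : ℝ) :
    ∫ τ in (0 : ℝ)..t, Complex.exp (c * τ) = t * dslope Complex.exp 0 (c * t) := by
  rcases eq_or_ne c 0 with rfl | hc
  · simp
  rcases eq_or_ne t 0 with rfl | ht
  · simp
  have ht' : (t : ℂ) ≠ 0 := by exact_mod_cast ht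
  rw [integral_exp_mul_complex hc, dslope_of_ne _ (mul_ne_zero hc ht'), slope_def_field]
  simp only [Complex.ofReal_zero, mul_zero, Complex.exp_zero, sub_zero]
  field_simp

theorem entireFamily_freqMatrix (V : ℝ → ℝ) (α : ℝ) (k j : ℤ) :
    EntireFamily fun z (p : ℝ × ℝ) => freqMatrix V α z p.1 k j := by
  have h : (fun z (p : ℝ × ℝ) => freqMatrix V α z p.1 k j) = fun z p => potCoeff V (k - j) *
      (p.1 * dslope Complex.exp 0 (Complex.I * ((2 * z + α * (k + j)) * (k - j)) * p.1)) := by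
    ext z p
    rw [freqMatrix, ← integral_cexp_eq_dslope]
    simp only [mul_assoc]
  have hd := differentiable_dslope_exp
  rw [h]
  refine ⟨?_, fun p => by fun_prop⟩
  have := hd.continuous
  unfold Function.uncurry
  fun_prop

theorem entireFamily_bandMatrix (V : ℝ → ℝ) (α : ℝ) (M : ℕ) (k j : ℤ) :
    EntireFamily fun z (p : ℝ × ℝ) => bandMatrix V α M z p.1 k j := by
  unfold bandMatrix
  split_ifs
  · exact entireFamily_freqMatrix V α k j
  · exact EntireFamily.const 0

/-- The band structure makes the sums in the matrix products finite. -/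
theorem entireFamily_infPow (V : ℝ → ℝ) (α : ℝ) (M n : ℕ) (k j : ℤ) :
    EntireFamily fun z (p : ℝ × ℝ) => infPow (bandMatrix V α M z p.1) n k j := by
  induction n generalizing k with
  | zero => exact EntireFamily.const _
  | succ n ih =>
    have h : (fun z (p : ℝ × ℝ) => infPow (bandMatrix V α M z p.1) (n + 1) k j) =
        fun z p => ∑ m ∈ Finset.Icc (k - M) (k + M), bandMatrix V α M z p.1 k m *
          infPow (bandMatrix V α M z p.1) n m j := by
      ext z p
      refine tsum_eq_sum fun m hm => ?_
      rw [bandMatrix, if_neg, zero_mul]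
      rw [Finset.mem_Icc] at hm ⊢
      omega
    rw [h]
    exact EntireFamily.sum fun m _ => (entireFamily_bandMatrix V α M k m).mul (ih m)

noncomputable section

/-- The factor `wave` for a complex frequency. -/
def waveC (α : ℝ) (z : ℂ) (k : ℤ) (t x : ℝ) : ℂ :=
  Complex.exp (-(Complex.I * (α : ℂ) * (k : ℂ) ^ 2 * (t : ℂ))) *
    Complex.exp (-(Complex.I * z ^ 2 * (t : ℂ))) *
    Complex.exp (-(2 * Complex.I * z * (t : ℂ))) *
    Complex.exp (Complex.I * ((k : ℂ) + z) * (x : ℂ))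

/-- The truncation `φ_{K,M,N}^{α,z}` for a complex frequency. -/
def phiTruncC (V : ℝ → ℝ) (α : ℝ) (K M N : ℕ) (z : ℂ) (p : ℝ × ℝ) : ℂ :=
  ∑ k ∈ Finset.Icc (-(K : ℤ)) (K : ℤ), (∑ n ∈ Finset.range (N + 1),
    infPow (bandMatrix V α M z p.1) n k 0 * (n.factorial : ℂ)⁻¹) * waveC α z k p.1 p.2

end

theorem phiTruncC_ofReal (V : ℝ → ℝ) (α : ℝ) (K M N : ℕ) (ω : ℝ) :
    phiTruncC V α K M N ω = phiTrunc V α K M N ω := by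
  ext p
  refine Finset.sum_congr rfl fun k _ => ?_
  rw [infMulVec_delta0, infExpTrunc_eq_sum, truncB_eq]
  rfl

theorem entireFamily_waveC (α : ℝ) (k : ℤ) :
    EntireFamily fun z (p : ℝ × ℝ) => waveC α z k p.1 p.2 := by
  unfold waveC
  refine ⟨?_, fun p => by fun_prop⟩
  unfold Function.uncurry
  fun_prop

theorem entireFamily_phiTruncC (V : ℝ → ℝ) (α : ℝ) (K M N : ℕ) :
    EntireFamily (phiTruncC V α K M N) := by
  unfold phiTruncC
  exact EntireFamily.sum fun k _ => (EntireFamily.sum fun n _ =>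
    (entireFamily_infPow V α M n k 0).mul (EntireFamily.const _)).mul (entireFamily_waveC α k)

theorem continuous_phiTrunc (V : ℝ → ℝ) (α : ℝ) (K M N : ℕ) (ω : ℝ) :
    Continuous (phiTrunc V α K M N ω) := by
  rw [← phiTruncC_ofReal]
  exact (entireFamily_phiTruncC V α K M N).continuous_right ω

theorem tendsto_phiTrunc_diag {V : ℝ → ℝ} (hV : Summable fun k => ‖potCoeff V k‖) (α ω : ℝ)
    (p : ℝ × ℝ) :
    Tendsto (fun n : ℕ => phiTrunc V α n n n ω p) atTop (𝓝 (phi V α ω p)) := by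
  have hd : Tendsto (fun n : ℕ => (n, n, n)) atTop (atTop ×ˢ atTop ×ˢ atTop) :=
    tendsto_id.prodMk (tendsto_id.prodMk tendsto_id)
  have h := (tendsto_phiTrunc hV α ω p).comp hd
  simpa only [Function.comp_def] using h

theorem stronglyMeasurable_phi {V : ℝ → ℝ} (hV : Summable fun k => ‖potCoeff V k‖) (α ω : ℝ) :
    StronglyMeasurable (phi V α ω) :=
  stronglyMeasurable_of_tendsto (u := atTop) (f := fun n => phiTrunc V α n n n ω)
    (fun n => (continuous_phiTrunc V α n n n ω).stronglyMeasurable)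
    (tendsto_pi_nhds.mpr (tendsto_phiTrunc_diag hV α ω))

/-! ### Functions of exponential growth in time as distributions -/

/-- Measurable functions bounded by `e^{S|t|}`, uniformly in `x`. -/
structure HasTimeGrowth (S : ℝ) (f : ℝ × ℝ → ℂ) : Prop where
  stronglyMeasurable : StronglyMeasurable f
  norm_le : ∀ p, ‖f p‖ ≤ Real.exp (|p.1| * S)

theorem hasTimeGrowth_phi {V : ℝ → ℝ} (hV : Summable fun k => ‖potCoeff V k‖) (α ω : ℝ) :
    HasTimeGrowth (∑' k, ‖potCoeff V k‖) (phi V α ω) :=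
  ⟨stronglyMeasurable_phi hV α ω, norm_phi_le hV α ω⟩

theorem hasTimeGrowth_phiTrunc {V : ℝ → ℝ} (hV : Summable fun k => ‖potCoeff V k‖) (α : ℝ)
    (K M N : ℕ) (ω : ℝ) :
    HasTimeGrowth (∑' k, ‖potCoeff V k‖) (phiTrunc V α K M N ω) :=
  ⟨(continuous_phiTrunc V α K M N ω).stronglyMeasurable, norm_phiTrunc_le hV α K M N ω⟩

theorem integrable_halfMeasure {E : Type*} [NormedAddCommGroup E] {f : ℝ × ℝ → E}
    (hf : Integrable f) : Integrable f halfMeasure :=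
  hf.restrict

theorem isLocallyFiniteMeasure_halfMeasure : IsLocallyFiniteMeasure halfMeasure := by
  unfold halfMeasure; infer_instance

theorem HasTimeGrowth.locallyIntegrable {S : ℝ} {f : ℝ × ℝ → ℂ} (hf : HasTimeGrowth S f) :
    LocallyIntegrable f halfMeasure := by
  have := isLocallyFiniteMeasure_halfMeasure
  have h : LocallyIntegrable (fun p : ℝ × ℝ => Real.exp (|p.1| * S)) halfMeasure :=
    Continuous.locallyIntegrable (by fun_prop)
  refine h.mono hf.stronglyMeasurable.aestronglyMeasurable (Eventually.of_forall fun p => ?_)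
  rw [Real.norm_of_nonneg (Real.exp_pos _).le]
  exact hf.norm_le p

theorem halfDist_apply {f : ℝ × ℝ → ℂ} (hf : LocallyIntegrable f halfMeasure)
    (g : 𝓓((⊤ : TopologicalSpace.Opens (ℝ × ℝ)), ℝ)) :
    halfDist f g = ∫ p, f p * (g p : ℂ) ∂halfMeasure := by
  refine (TestFunction.integralAgainstBilinCLM_eq_integral (hf.locallyIntegrableOn _)).trans ?_
  congr 1; ext p
  simp [mul_comm]

theorem HasTimeGrowth.norm_mul_le {S R : ℝ} (hS : 0 ≤ S) {f : ℝ × ℝ → ℂ}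
    (hf : HasTimeGrowth S f) {E : Type*} [NormedAddCommGroup E] {g : ℝ × ℝ → E}
    (hg : ∀ t x : ℝ, R < |t| → g (t, x) = 0) (p : ℝ × ℝ) :
    ‖f p‖ * ‖g p‖ ≤ Real.exp (R * S) * ‖g p‖ := by
  by_cases h : R < |p.1|
  · rw [hg p.1 p.2 h]; simp
  · gcongr
    refine (hf.norm_le p).trans ?_
    gcongr
    exact not_lt.mp h

theorem HasTimeGrowth.integrable_mul_schwartz {S : ℝ} (hS : 0 ≤ S) {f : ℝ × ℝ → ℂ}
    (hf : HasTimeGrowth S f) {g : 𝓢(ℝ × ℝ, ℂ)} (hg : HasBoundedTimeSupport g) :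
    Integrable (fun p => f p * g p) halfMeasure := by
  obtain ⟨R, hR⟩ := hg
  refine (integrable_halfMeasure (g.integrable.norm.const_mul (Real.exp (R * S)))).mono'
    (hf.stronglyMeasurable.mul g.continuous.stronglyMeasurable).aestronglyMeasurable
    (Eventually.of_forall fun p => ?_)
  rw [norm_mul]
  exact hf.norm_mul_le hS hR p

theorem tendsto_integral_mul_schwartz {ι : Type*} {l : Filter ι} [l.IsCountablyGenerated]
    {S : ℝ} (hS : 0 ≤ S) {F : ι → ℝ × ℝ → ℂ} {f : ℝ × ℝ → ℂ} (hF : ∀ i, HasTimeGrowth S (F i))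
    (hlim : ∀ p, Tendsto (fun i => F i p) l (𝓝 (f p))) {g : 𝓢(ℝ × ℝ, ℂ)}
    (hg : HasBoundedTimeSupport g) :
    Tendsto (fun i => ∫ p, F i p * g p ∂halfMeasure) l (𝓝 (∫ p, f p * g p ∂halfMeasure)) := by
  obtain ⟨R, hR⟩ := hg
  refine tendsto_integral_filter_of_dominated_convergence
    (fun p => Real.exp (R * S) * ‖g p‖)
    (Eventually.of_forall fun i => ((hF i).stronglyMeasurable.mul
      g.continuous.stronglyMeasurable).aestronglyMeasurable)
    (Eventually.of_forall fun i => Eventually.of_forall fun p => ?_)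
    (integrable_halfMeasure (g.integrable.norm.const_mul _))
    (Eventually.of_forall fun p => (hlim p).mul_const _)
  rw [norm_mul]
  exact (hF i).norm_mul_le hS hR p

/-! ### Regularization at the pole of the circle -/

/-- The test function `g` in the stereographic coordinate `x`, minus its first-order Taylor
polynomial at the pole `θ = π`, with `-sin θ` in place of `θ - π` to keep it periodic. It is
`O(x⁻²)`, hence integrable in `x` against bounded functions. -/
noncomputable def poleReg (g : ℝ × ℝ → ℝ) (p : ℝ × ℝ) : ℝ :=
  g (p.1, 2 * Real.arctan p.2) - g (p.1, Real.pi) +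
    fderiv ℝ g (p.1, Real.pi) (0, 1) * Real.sin (2 * Real.arctan p.2)

theorem hasDerivAt_slice {g : ℝ × ℝ → ℝ} (hg : Differentiable ℝ g) (t θ : ℝ) :
    HasDerivAt (fun θ => g (t, θ)) (fderiv ℝ g (t, θ) (0, 1)) θ :=
  (hg (t, θ)).hasFDerivAt.comp_hasDerivAt θ ((hasDerivAt_const θ t).prodMk (hasDerivAt_id θ))

/-- Taylor's estimate at `θ = π`. The function on the left vanishes there to first order, and
`g` and the sine term, whose coefficient is at most `b`, each contribute `b` to the bound `2 b` of
the second derivative. -/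
theorem abs_taylor_le {g : ℝ × ℝ → ℝ} (hg : ContDiff ℝ 2 g) {b : ℝ}
    (hb1 : ∀ p, ‖fderiv ℝ g p‖ ≤ b) (hb2 : ∀ p, ‖fderiv ℝ (fderiv ℝ g) p‖ ≤ b) (t θ : ℝ) :
    |g (t, θ) - g (t, Real.pi) + fderiv ℝ g (t, Real.pi) (0, 1) * Real.sin θ| ≤
      2 * b * (θ - Real.pi) ^ 2 := by
  have hd1 : Differentiable ℝ (fderiv ℝ g) :=
    (hg.fderiv_right (m := 1) (by norm_num)).differentiable one_ne_zero
  have hone : ‖((0 : ℝ), (1 : ℝ))‖ = 1 := by simp [Prod.norm_def]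
  set d := fderiv ℝ g (t, Real.pi) (0, 1) with hd
  have hdb : |d| ≤ b := by
    have := (fderiv ℝ g (t, Real.pi)).le_opNorm (0, 1)
    rw [hone, mul_one] at this
    exact this.trans (hb1 _)
  have hder : ∀ ξ : ℝ, HasDerivAt (fun θ => g (t, θ) - g (t, Real.pi) + d * Real.sin θ)
      (fderiv ℝ g (t, ξ) (0, 1) + d * Real.cos ξ) ξ := fun ξ =>
    ((hasDerivAt_slice (hg.differentiable two_ne_zero) t ξ).sub_const _).add
      ((Real.hasDerivAt_sin ξ).const_mul d)
  have hderb : ∀ ξ : ℝ, |fderiv ℝ g (t, ξ) (0, 1) + d * Real.cos ξ| ≤ 2 * b * |ξ - Real.pi| := by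
    intro ξ
    have h1 : |fderiv ℝ g (t, ξ) (0, 1) - d| ≤ b * |ξ - Real.pi| := by
      have h := Convex.norm_image_sub_le_of_norm_fderiv_le (𝕜 := ℝ) (f := fderiv ℝ g)
        (fun p _ => hd1 p) (fun p _ => hb2 p) convex_univ
        (Set.mem_univ (t, Real.pi)) (Set.mem_univ (t, ξ))
      have h2 : ‖((t, ξ) : ℝ × ℝ) - (t, Real.pi)‖ = |ξ - Real.pi| := by simp [Prod.norm_def]
      rw [h2] at h
      have h3 := (fderiv ℝ g (t, ξ) - fderiv ℝ g (t, Real.pi)).le_opNorm (0, 1)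
      rw [hone, mul_one] at h3
      exact h3.trans h
    have h2 : |1 + Real.cos ξ| ≤ |ξ - Real.pi| := by
      have := Real.abs_cos_sub_cos_le ξ Real.pi
      rwa [Real.cos_pi, sub_neg_eq_add, add_comm] at this
    have h3 : fderiv ℝ g (t, ξ) (0, 1) + d * Real.cos ξ =
        (fderiv ℝ g (t, ξ) (0, 1) - d) + d * (1 + Real.cos ξ) := by ring
    rw [h3]
    refine (abs_add_le _ _).trans ?_
    rw [abs_mul]
    nlinarith [mul_le_mul hdb h2 (abs_nonneg _) ((abs_nonneg d).trans hdb)]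
  have hb0 : 0 ≤ b := (abs_nonneg d).trans hdb
  have key := (convex_uIcc Real.pi θ).norm_image_sub_le_of_norm_hasDerivWithin_le
    (C := 2 * b * |θ - Real.pi|)
    (fun ξ _ => (hder ξ).hasDerivWithinAt) (fun ξ hξ => (hderb ξ).trans
      (mul_le_mul_of_nonneg_left (Set.abs_sub_left_of_mem_uIcc hξ) (by positivity)))
    Set.left_mem_uIcc Set.right_mem_uIcc
  simp only [Real.sin_pi, mul_zero, add_zero, sub_self, sub_zero, Real.norm_eq_abs] at key
  refine key.trans_eq ?_
  rw [mul_assoc, ← sq, sq_abs]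

theorem sq_le_mul_one_sub_cos {s : ℝ} (hs : |s| ≤ Real.pi) :
    s ^ 2 ≤ Real.pi ^ 2 / 2 * (1 - Real.cos s) := by
  have h := Real.cos_le_one_sub_mul_cos_sq hs
  have hpi := Real.pi_pos
  have h2 : s ^ 2 = Real.pi ^ 2 / 2 * (2 / Real.pi ^ 2 * s ^ 2) := by field_simp
  rw [h2]
  gcongr
  linarith

/-- The `O(x⁻²)` bound of the regularized test function. -/
theorem abs_poleReg_le {g : ℝ × ℝ → ℝ} (hg : ContDiff ℝ 2 g)
    (hper : ∀ t θ : ℝ, g (t, θ + 2 * Real.pi) = g (t, θ)) {b : ℝ}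
    (hb1 : ∀ p, ‖fderiv ℝ g p‖ ≤ b) (hb2 : ∀ p, ‖fderiv ℝ (fderiv ℝ g) p‖ ≤ b) (p : ℝ × ℝ) :
    |poleReg g p| ≤ b * (2 * Real.pi ^ 2 * (1 + p.2 ^ 2)⁻¹) := by
  obtain ⟨t, x⟩ := p
  have hb0 : 0 ≤ b := (norm_nonneg _).trans (hb1 0)
  -- The representative of the angle modulo `2π` which is closest to `π`.
  obtain ⟨θ, hθ, hg1, hs, hc⟩ : ∃ θ : ℝ, |θ - Real.pi| ≤ Real.pi ∧
      g (t, θ) = g (t, 2 * Real.arctan x) ∧ Real.sin θ = Real.sin (2 * Real.arctan x) ∧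
      Real.cos θ = Real.cos (2 * Real.arctan x) := by
    have h1 := Real.arctan_lt_pi_div_two x
    have h2 := Real.neg_pi_div_two_lt_arctan x
    rcases le_total 0 (Real.arctan x) with h | h
    · exact ⟨2 * Real.arctan x, abs_le.mpr ⟨by linarith, by linarith⟩, rfl, rfl, rfl⟩
    · exact ⟨2 * Real.arctan x + 2 * Real.pi, abs_le.mpr ⟨by linarith, by linarith⟩,
        hper _ _, Real.sin_add_two_pi _, Real.cos_add_two_pi _⟩
  have h1 := abs_taylor_le hg hb1 hb2 t θ
  have h2 := sq_le_mul_one_sub_cos hθ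
  have h3 : 1 - Real.cos (θ - Real.pi) = 2 * (1 + x ^ 2)⁻¹ := by
    rw [Real.cos_sub_pi, hc, Real.cos_two_mul, Real.cos_sq_arctan]; ring
  rw [hg1, hs] at h1
  rw [h3] at h2
  refine h1.trans ?_
  calc 2 * b * (θ - Real.pi) ^ 2
      ≤ 2 * b * (Real.pi ^ 2 / 2 * (2 * (1 + x ^ 2)⁻¹)) := by gcongr
    _ = b * (2 * Real.pi ^ 2 * (1 + x ^ 2)⁻¹) := by ring

theorem norm_fderiv_le_of_iteratedFDeriv {g : ℝ × ℝ → ℝ} {b : ℝ}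
    (hb : ∀ j ≤ 2, ∀ p, ‖iteratedFDeriv ℝ j g p‖ ≤ b) :
    (∀ p, ‖fderiv ℝ g p‖ ≤ b) ∧ ∀ p, ‖fderiv ℝ (fderiv ℝ g) p‖ ≤ b := by
  refine ⟨fun p => ?_, fun p => ?_⟩
  · rw [← norm_iteratedFDeriv_one]; exact hb 1 one_le_two p
  · rw [← norm_iteratedFDeriv_one, norm_iteratedFDeriv_fderiv]; exact hb 2 le_rfl p

namespace cylinderTest

variable (g : cylinderTest)

theorem contDiff : ContDiff ℝ ((⊤ : ℕ∞) : WithTop ℕ∞) (g : ℝ × ℝ → ℝ) := g.2.1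

theorem differentiable : Differentiable ℝ (g : ℝ × ℝ → ℝ) :=
  (contDiff g).differentiable (by simp)

variable {g} in
theorem iteratedFDeriv_eq_zero {R : ℝ}
    (hR : ∀ t θ : ℝ, R < |t| → (g : ℝ × ℝ → ℝ) (t, θ) = 0) (j : ℕ) {t : ℝ} (ht : R < |t|) (θ : ℝ) :
    iteratedFDeriv ℝ j (g : ℝ × ℝ → ℝ) (t, θ) = 0 := by
  have hopen : IsOpen {p : ℝ × ℝ | R < |p.1|} := isOpen_lt (by fun_prop) (by fun_prop)
  have h : (g : ℝ × ℝ → ℝ) =ᶠ[𝓝 (t, θ)] 0 := by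
    filter_upwards [hopen.mem_nhds (show (t, θ) ∈ {p : ℝ × ℝ | R < |p.1|} from ht)] with p hp
    exact hR p.1 p.2 hp
  have h2 := (h.iteratedFDeriv ℝ j).eq_of_nhds
  rw [h2]
  simp

theorem exists_iteratedFDeriv_le (j : ℕ) :
    ∃ b, ∀ p, ‖iteratedFDeriv ℝ j (g : ℝ × ℝ → ℝ) p‖ ≤ b := by
  obtain ⟨R, hR⟩ := g.2.2.2
  have hcont : Continuous (iteratedFDeriv ℝ j (g : ℝ × ℝ → ℝ)) :=
    (contDiff g).continuous_iteratedFDeriv (by exact_mod_cast le_top)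
  obtain ⟨b, hb⟩ := ((isCompact_Icc (a := -R) (b := R)).prod
    (isCompact_Icc (a := 0) (b := 2 * Real.pi))).exists_bound_of_continuousOn hcont.continuousOn
  refine ⟨max b 0, fun p => ?_⟩
  obtain ⟨t, θ⟩ := p
  by_cases ht : R < |t|
  · rw [iteratedFDeriv_eq_zero hR j ht]; simp
  have hper : Function.Periodic
      (fun θ => iteratedFDeriv ℝ j (g : ℝ × ℝ → ℝ) (t, θ)) (2 * Real.pi) := by
    intro θ
    have h1 : (fun p : ℝ × ℝ => (g : ℝ × ℝ → ℝ) (p + (0, 2 * Real.pi))) = g := by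
      ext p
      have := g.2.2.1 p.1 p.2
      simpa [Prod.add_def] using this
    have h2 := iteratedFDeriv_comp_add_right (𝕜 := ℝ) (f := (g : ℝ × ℝ → ℝ)) j
      (0, 2 * Real.pi) (t, θ)
    rw [h1] at h2
    simpa using h2.symm
  obtain ⟨y, hy, hy2⟩ := hper.exists_mem_Ico₀ Real.two_pi_pos θ
  rw [show iteratedFDeriv ℝ j (g : ℝ × ℝ → ℝ) (t, θ) = _ from hy2]
  exact (hb _ ⟨abs_le.mp (not_lt.mp ht), hy.1, hy.2.le⟩).trans (le_max_left _ _)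

theorem exists_bound (m : ℕ) :
    ∃ b, ∀ j ≤ m, ∀ p, ‖iteratedFDeriv ℝ j (g : ℝ × ℝ → ℝ) p‖ ≤ b := by
  choose b hb using exists_iteratedFDeriv_le g
  refine ⟨∑ j ∈ Finset.range (m + 1), |b j|, fun j hj p => ((hb j p).trans (le_abs_self _)).trans ?_⟩
  exact Finset.single_le_sum (f := fun j => |b j|) (fun i _ => abs_nonneg _)
    (Finset.mem_range.mpr (by omega))

theorem continuous_poleReg : Continuous (poleReg (g : ℝ × ℝ → ℝ)) := by
  have h1 : Continuous (g : ℝ × ℝ → ℝ) := (contDiff g).continuous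
  have h2 : Continuous (fderiv ℝ (g : ℝ × ℝ → ℝ)) := (contDiff g).continuous_fderiv (by simp)
  have h3 := Real.continuous_arctan
  unfold poleReg
  fun_prop

theorem fderiv_eq_zero {t θ : ℝ} (h : iteratedFDeriv ℝ 1 (g : ℝ × ℝ → ℝ) (t, θ) = 0) :
    fderiv ℝ (g : ℝ × ℝ → ℝ) (t, θ) = 0 := by
  rw [← norm_eq_zero, ← norm_iteratedFDeriv_one, h, norm_zero]

variable {g} in
theorem poleReg_eq_zero {R : ℝ} (hR : ∀ t θ : ℝ, R < |t| → (g : ℝ × ℝ → ℝ) (t, θ) = 0)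
    {p : ℝ × ℝ} (hp : R < |p.1|) : poleReg (g : ℝ × ℝ → ℝ) p = 0 := by
  rw [poleReg, hR _ _ hp, hR _ _ hp, fderiv_eq_zero g (iteratedFDeriv_eq_zero hR 1 hp _)]
  simp

theorem poleReg_add (g h : cylinderTest) (p : ℝ × ℝ) :
    poleReg ((g + h : cylinderTest) : ℝ × ℝ → ℝ) p =
      poleReg (g : ℝ × ℝ → ℝ) p + poleReg (h : ℝ × ℝ → ℝ) p := by
  simp only [poleReg, Submodule.coe_add, Pi.add_apply]
  rw [fderiv_add (differentiable g _) (differentiable h _)]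
  simp only [add_apply]
  ring

theorem poleReg_smul (c : ℝ) (g : cylinderTest) (p : ℝ × ℝ) :
    poleReg ((c • g : cylinderTest) : ℝ × ℝ → ℝ) p = c * poleReg (g : ℝ × ℝ → ℝ) p := by
  simp only [poleReg, Submodule.coe_smul, Pi.smul_apply]
  rw [fderiv_const_smul (differentiable g _)]
  simp only [smul_apply, smul_eq_mul]
  ring

end cylinderTest

/-- The integrable function which, up to a constant, dominates the regularization of every test
function with time support in `[-R, R]`. -/
noncomputable def cylDominator (S R : ℝ) (p : ℝ × ℝ) : ℝ :=
  (Set.Icc (-R) R).indicator (fun _ => Real.exp (R * S)) p.1 *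
    (2 * Real.pi ^ 2 * (1 + p.2 ^ 2)⁻¹)

theorem integrable_cylDominator (S R : ℝ) : Integrable (cylDominator S R) halfMeasure := by
  refine integrable_halfMeasure ?_
  exact Integrable.mul_prod (μ := volume) (ν := volume)
    (f := (Set.Icc (-R) R).indicator fun _ => Real.exp (R * S))
    (g := fun x => 2 * Real.pi ^ 2 * (1 + x ^ 2)⁻¹)
    ((integrable_indicator_iff measurableSet_Icc).mpr (integrableOn_const (by simp)))
    (integrable_inv_one_add_sq.const_mul _)

section

variable {S : ℝ} {f : ℝ × ℝ → ℂ}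

theorem HasTimeGrowth.norm_mul_poleReg_le (hS : 0 ≤ S) (hf : HasTimeGrowth S f) {g : cylinderTest}
    {R b : ℝ} (hR : ∀ t θ : ℝ, R < |t| → (g : ℝ × ℝ → ℝ) (t, θ) = 0)
    (hb : ∀ j ≤ 2, ∀ p, ‖iteratedFDeriv ℝ j (g : ℝ × ℝ → ℝ) p‖ ≤ b) (p : ℝ × ℝ) :
    ‖f p * (poleReg (g : ℝ × ℝ → ℝ) p : ℂ)‖ ≤ cylDominator S R p * b := by
  rw [norm_mul, Complex.norm_real]
  by_cases h : R < |p.1|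
  · have h' : p.1 ∉ Set.Icc (-R) R := fun hp => absurd (abs_le.mpr hp) (not_le.mpr h)
    rw [cylinderTest.poleReg_eq_zero hR h, cylDominator, Set.indicator_of_notMem h']
    simp
  · have h' : p.1 ∈ Set.Icc (-R) R := abs_le.mp (not_lt.mp h)
    rw [cylDominator, Set.indicator_of_mem h', mul_assoc]
    have hb' := norm_fderiv_le_of_iteratedFDeriv hb
    refine mul_le_mul ((hf.norm_le p).trans (by gcongr; exact not_lt.mp h)) ?_ (norm_nonneg _)
      (Real.exp_pos _).le
    rw [mul_comm, Real.norm_eq_abs]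
    exact abs_poleReg_le (contDiff_infty.mp (cylinderTest.contDiff g) 2) g.2.2.1
      hb'.1 hb'.2 p

theorem HasTimeGrowth.aestronglyMeasurable_mul_poleReg (hf : HasTimeGrowth S f)
    (g : cylinderTest) :
    AEStronglyMeasurable (fun p => f p * (poleReg (g : ℝ × ℝ → ℝ) p : ℂ)) halfMeasure :=
  (hf.stronglyMeasurable.mul (Complex.continuous_ofReal.comp
    (cylinderTest.continuous_poleReg g)).stronglyMeasurable).aestronglyMeasurable

theorem HasTimeGrowth.integrable_mul_poleReg (hS : 0 ≤ S) (hf : HasTimeGrowth S f)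
    (g : cylinderTest) :
    Integrable (fun p => f p * (poleReg (g : ℝ × ℝ → ℝ) p : ℂ)) halfMeasure := by
  obtain ⟨R, hR⟩ := g.2.2.2
  obtain ⟨b, hb⟩ := cylinderTest.exists_bound g 2
  exact ((integrable_cylDominator S R).mul_const b).mono' (hf.aestronglyMeasurable_mul_poleReg g)
    (Eventually.of_forall (hf.norm_mul_poleReg_le hS hR hb))

/-- The extension of `halfDist f` to the cylinder, by regularization at the pole. -/
noncomputable def cylExtension (hS : 0 ≤ S) (hf : HasTimeGrowth S f) : CylinderDistribution where
  toLin :=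
    { toFun := fun g => ∫ p, f p * (poleReg (g : ℝ × ℝ → ℝ) p : ℂ) ∂halfMeasure
      map_add' := fun g h => by
        rw [← integral_add (hf.integrable_mul_poleReg hS g) (hf.integrable_mul_poleReg hS h)]
        congr 1; ext p
        rw [cylinderTest.poleReg_add]; push_cast; ring
      map_smul' := fun c g => by
        rw [RingHom.id_apply, ← integral_smul]
        congr 1; ext p
        rw [cylinderTest.poleReg_smul, Complex.real_smul]; push_cast; ring }
  bound := fun R => ⟨2, ∫ p, cylDominator S R p ∂halfMeasure, fun g hR b hb => by
    rw [← integral_mul_const]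
    exact norm_integral_le_of_norm_le ((integrable_cylDominator S R).mul_const b)
      (Eventually.of_forall (hf.norm_mul_poleReg_le hS hR hb))⟩
  support := by
    rintro g ⟨ε, hε, hg⟩
    refine (setIntegral_congr_fun (measurableSet_le measurable_const measurable_fst)
      (g := fun _ => 0) ?_).trans (by simp)
    intro p hp
    have hp' : -ε < p.1 := lt_of_lt_of_le (neg_lt_zero.mpr hε) hp
    have hopen : IsOpen {p : ℝ × ℝ | -ε < p.1} := isOpen_lt (by fun_prop) (by fun_prop)
    have h : (g : ℝ × ℝ → ℝ) =ᶠ[𝓝 (p.1, Real.pi)] fun _ => 0 := by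
      filter_upwards [hopen.mem_nhds
        (show (p.1, Real.pi) ∈ {p : ℝ × ℝ | -ε < p.1} from hp')] with q hq
      exact hg q.1 q.2 hq
    have h0 : poleReg (g : ℝ × ℝ → ℝ) p = 0 := by
      rw [poleReg, hg _ _ hp', hg _ _ hp', h.fderiv_eq]
      simp
    simp [h0]

/-- A test function with compact support in the stereographic coordinate vanishes to first order
at the pole, so that it is not changed by the regularization. -/
theorem poleReg_eq_of_compactSupport {g : cylinderTest}
    {u : 𝓓((⊤ : TopologicalSpace.Opens (ℝ × ℝ)), ℝ)}
    (hu : ∀ t x : ℝ, u (t, x) = (g : ℝ × ℝ → ℝ) (t, 2 * Real.arctan x)) (p : ℝ × ℝ) :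
    poleReg (g : ℝ × ℝ → ℝ) p = u p := by
  have hlim : Tendsto (fun x => 2 * Real.arctan x) atTop (𝓝[≠] Real.pi) := by
    refine tendsto_nhdsWithin_iff.mpr ⟨?_, Eventually.of_forall fun x => ?_⟩
    · have := (tendsto_nhds_of_tendsto_nhdsWithin Real.tendsto_arctan_atTop).const_mul 2
      rwa [mul_div_cancel₀ _ two_ne_zero] at this
    · have := Real.arctan_lt_pi_div_two x
      exact ne_of_lt (by linarith)
  have hzero : ∀ᶠ x : ℝ in atTop, (g : ℝ × ℝ → ℝ) (p.1, 2 * Real.arctan x) = 0 := by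
    obtain ⟨X, hX⟩ := u.hasCompactSupport.isBounded.exists_norm_le
    filter_upwards [eventually_gt_atTop X] with x hx
    rw [← hu]
    by_contra h
    have h1 := (norm_snd_le (p.1, x)).trans (hX _ (subset_tsupport _ h))
    exact absurd ((le_abs_self x).trans h1) (not_le.mpr hx)
  have hd := hasDerivAt_slice (cylinderTest.differentiable g) p.1 Real.pi
  have h0 : (g : ℝ × ℝ → ℝ) (p.1, Real.pi) = 0 := by
    have h1 := hd.continuousAt.tendsto.comp (tendsto_nhds_of_tendsto_nhdsWithin hlim)
    exact tendsto_nhds_unique (h1.congr' hzero) tendsto_const_nhds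
  have h1 : fderiv ℝ (g : ℝ × ℝ → ℝ) (p.1, Real.pi) (0, 1) = 0 := by
    have h2 := (hasDerivAt_iff_tendsto_slope.mp hd).comp hlim
    refine tendsto_nhds_unique (h2.congr' ?_) tendsto_const_nhds
    filter_upwards [hzero] with x hx
    simp [slope_def_field, hx, h0]
  rw [poleReg, h0, h1, ← hu]
  simp

theorem cylExtension_extends (hS : 0 ≤ S) (hf : HasTimeGrowth S f) :
    (cylExtension hS hf).Extends (halfDist f) := by
  intro g u hu
  rw [halfDist_apply hf.locallyIntegrable]
  change ∫ p, f p * (poleReg (g : ℝ × ℝ → ℝ) p : ℂ) ∂halfMeasure = _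
  simp_rw [poleReg_eq_of_compactSupport hu]

theorem tendstoOnCylinder_of_hasTimeGrowth {ι : Type*} {l : Filter ι} [l.IsCountablyGenerated]
    (hS : 0 ≤ S) {F : ι → ℝ × ℝ → ℂ} (hF : ∀ i, HasTimeGrowth S (F i)) (hf : HasTimeGrowth S f)
    (hlim : ∀ p, Tendsto (fun i => F i p) l (𝓝 (f p))) :
    TendstoOnCylinder (fun i => halfDist (F i)) l (halfDist f) := by
  refine ⟨fun i => cylExtension hS (hF i), cylExtension hS hf,
    fun i => cylExtension_extends hS (hF i), cylExtension_extends hS hf, fun g => ?_⟩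
  obtain ⟨R, hR⟩ := g.2.2.2
  obtain ⟨b, hb⟩ := cylinderTest.exists_bound g 2
  exact tendsto_integral_filter_of_dominated_convergence (fun p => cylDominator S R p * b)
    (Eventually.of_forall fun i => (hF i).aestronglyMeasurable_mul_poleReg g)
    (Eventually.of_forall fun i => Eventually.of_forall ((hF i).norm_mul_poleReg_le hS hR hb))
    ((integrable_cylDominator S R).mul_const b)
    (Eventually.of_forall fun p => (hlim p).mul_const _)

end

/-! ### Bernstein operators on entire functions -/

/-- The moment `∑_ν (n choose ν) x^{n-ν} (1-x)^ν (n-ν)^m` of the Bernstein weights, for a real `x`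
which need not lie in `[0, 1]`. -/
noncomputable def bernsteinMoment (x : ℝ) (n m : ℕ) : ℝ :=
  ∑ ν ∈ Finset.range (n + 1), (n.choose ν : ℝ) * x ^ (n - ν) * (1 - x) ^ ν * ((n - ν : ℕ) : ℝ) ^ m

theorem bernsteinMoment_zero_right (x : ℝ) (n : ℕ) : bernsteinMoment x n 0 = 1 := by
  have h := add_pow (1 - x) x n
  rw [sub_add_cancel, one_pow] at h
  rw [h, bernsteinMoment]
  refine Finset.sum_congr rfl fun ν _ => ?_
  ring

/-- The recursion which follows from `(n + 1 - ν) (n+1 choose ν) = (n + 1) (n choose ν)`. -/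
theorem bernsteinMoment_succ_succ (x : ℝ) (n m : ℕ) :
    bernsteinMoment x (n + 1) (m + 1) = (n + 1) * x *
      ∑ i ∈ Finset.range (m + 1), (m.choose i : ℝ) * bernsteinMoment x n i := by
  have h1 : ∀ ν ∈ Finset.range (n + 1), ((n + 1).choose ν : ℝ) * x ^ (n + 1 - ν) * (1 - x) ^ ν *
      ((n + 1 - ν : ℕ) : ℝ) ^ (m + 1) = (n + 1) * x * ∑ i ∈ Finset.range (m + 1),
        (m.choose i : ℝ) * ((n.choose ν : ℝ) * x ^ (n - ν) * (1 - x) ^ ν *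
          ((n - ν : ℕ) : ℝ) ^ i) := by
    intro ν hν
    have hν' : ν ≤ n := by rw [Finset.mem_range] at hν; omega
    have h2 : ((n + 1).choose ν : ℝ) * ((n + 1 - ν : ℕ) : ℝ) = (n.choose ν : ℝ) * (n + 1) := by
      exact_mod_cast (Nat.choose_mul_succ_eq n ν).symm
    have h3 : ((n + 1 - ν : ℕ) : ℝ) ^ m =
        ∑ i ∈ Finset.range (m + 1), ((n - ν : ℕ) : ℝ) ^ i * (m.choose i : ℝ) := by
      rw [Nat.sub_add_comm hν', Nat.cast_add, Nat.cast_one, add_pow]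
      simp
    calc ((n + 1).choose ν : ℝ) * x ^ (n + 1 - ν) * (1 - x) ^ ν * ((n + 1 - ν : ℕ) : ℝ) ^ (m + 1)
        = (((n + 1).choose ν : ℝ) * ((n + 1 - ν : ℕ) : ℝ)) * x ^ (n + 1 - ν) * (1 - x) ^ ν *
            ((n + 1 - ν : ℕ) : ℝ) ^ m := by ring
      _ = (n + 1) * x * ((n.choose ν : ℝ) * x ^ (n - ν) * (1 - x) ^ ν *
            ((n + 1 - ν : ℕ) : ℝ) ^ m) := by
          rw [h2, Nat.sub_add_comm hν', pow_succ]; ring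
      _ = _ := by
          rw [h3, Finset.mul_sum]
          congr 1
          exact Finset.sum_congr rfl fun i _ => by ring
  rw [bernsteinMoment, Finset.sum_range_succ]
  simp only [Nat.sub_self, Nat.cast_zero, zero_pow (Nat.succ_ne_zero m), mul_zero, add_zero]
  rw [Finset.sum_congr rfl h1, ← Finset.mul_sum, Finset.sum_comm]
  simp only [bernsteinMoment, Finset.mul_sum]

theorem abs_bernsteinMoment_le (x : ℝ) (n m : ℕ) :
    |bernsteinMoment x n m| ≤ (max 1 |x|) ^ m * n ^ m := by
  set r := max 1 |x| with hr
  have hr1 : 1 ≤ r := le_max_left _ _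
  induction m using Nat.strong_induction_on generalizing n with
  | _ m ih =>
    cases m with
    | zero => simp [bernsteinMoment_zero_right]
    | succ m =>
      cases n with
      | zero => simp [bernsteinMoment]
      | succ n =>
        rw [bernsteinMoment_succ_succ, abs_mul, abs_mul]
        have h1 : |∑ i ∈ Finset.range (m + 1), (m.choose i : ℝ) * bernsteinMoment x n i| ≤
            r ^ m * ((n : ℝ) + 1) ^ m := by
          refine (Finset.abs_sum_le_sum_abs _ _).trans ?_
          rw [add_pow, Finset.mul_sum]
          refine Finset.sum_le_sum fun i hi => ?_
          have hi' : i < m + 1 := Finset.mem_range.mp hi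
          rw [abs_mul, Nat.abs_cast, one_pow, mul_one]
          calc (m.choose i : ℝ) * |bernsteinMoment x n i|
              ≤ (m.choose i : ℝ) * (r ^ i * n ^ i) := by gcongr; exact ih i hi' n
            _ ≤ (m.choose i : ℝ) * (r ^ m * n ^ i) := by
                gcongr
                omega
            _ = r ^ m * ((n : ℝ) ^ i * (m.choose i : ℝ)) := by ring
        have h2 : |((n : ℝ) + 1)| = n + 1 := abs_of_nonneg (by positivity)
        rw [h2]
        calc ((n : ℝ) + 1) * |x| *
              |∑ i ∈ Finset.range (m + 1), (m.choose i : ℝ) * bernsteinMoment x n i|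
            ≤ ((n : ℝ) + 1) * r * (r ^ m * ((n : ℝ) + 1) ^ m) := by
              gcongr
              exact le_max_right _ _
          _ = r ^ (m + 1) * ((n + 1 : ℕ) : ℝ) ^ (m + 1) := by push_cast; ring

theorem abs_bernsteinMoment_div_le (x : ℝ) (n m : ℕ) :
    |bernsteinMoment x n m / n ^ m| ≤ (max 1 |x|) ^ m := by
  rw [abs_div, abs_of_nonneg (by positivity : (0 : ℝ) ≤ (n : ℝ) ^ m)]
  exact div_le_of_le_mul₀ (by positivity) (by positivity) (abs_bernsteinMoment_le x n m)

/-- The Bernstein operators converge on monomials: in the recursion only `i = m` contributes to the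
leading order `n ^ (m + 1)`. -/
theorem tendsto_bernsteinMoment (x : ℝ) (m : ℕ) :
    Tendsto (fun n : ℕ => bernsteinMoment x n m / n ^ m) atTop (𝓝 (x ^ m)) := by
  induction m with
  | zero => simp [bernsteinMoment_zero_right]
  | succ m ih =>
    rw [← tendsto_add_atTop_iff_nat 1]
    have hratio : Tendsto (fun n : ℕ => (n : ℝ) / (n + 1)) atTop (𝓝 1) :=
      tendsto_natCast_div_add_atTop 1
    have hlow : ∀ i ∈ Finset.range m, Tendsto (fun n : ℕ => (m.choose i : ℝ) *
        (bernsteinMoment x n i / ((n : ℝ) + 1) ^ m)) atTop (𝓝 0) := by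
      intro i hi
      have him : i < m := Finset.mem_range.mp hi
      have h1 : Tendsto (fun n : ℕ => (max 1 |x|) ^ i * (1 / ((n : ℝ) + 1))) atTop (𝓝 0) := by
        simpa using tendsto_one_div_add_atTop_nhds_zero_nat.const_mul ((max 1 |x|) ^ i)
      have h2 := squeeze_zero_norm (f := fun n : ℕ => bernsteinMoment x n i / ((n : ℝ) + 1) ^ m)
        (fun n => ?_) h1
      · simpa using h2.const_mul (m.choose i : ℝ)
      · have hn : (0 : ℝ) < (n : ℝ) + 1 := by positivity
        rw [norm_div, Real.norm_eq_abs, Real.norm_of_nonneg (by positivity), div_le_iff₀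
          (by positivity)]
        refine (abs_bernsteinMoment_le x n i).trans ?_
        rw [mul_assoc]
        gcongr
        obtain ⟨d, rfl⟩ := Nat.exists_eq_add_of_lt him
        rw [one_div, pow_succ, mul_comm (((n : ℝ) + 1) ^ (i + d)), inv_mul_cancel_left₀ hn.ne']
        calc (n : ℝ) ^ i ≤ ((n : ℝ) + 1) ^ i := by gcongr; linarith
          _ ≤ ((n : ℝ) + 1) ^ (i + d) := pow_le_pow_right₀ (by linarith) (by omega)
    have htop : Tendsto (fun n : ℕ => bernsteinMoment x n m / ((n : ℝ) + 1) ^ m) atTop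
        (𝓝 (x ^ m)) := by
      have h := ih.mul (hratio.pow m)
      rw [one_pow, mul_one] at h
      refine h.congr' ?_
      filter_upwards [eventually_gt_atTop 0] with n hn
      have hn' : (0 : ℝ) < n := by exact_mod_cast hn
      rw [div_pow]
      field_simp
    have hsum := ((tendsto_finsetSum _ hlow).add htop).const_mul x
    rw [Finset.sum_const_zero, zero_add, ← pow_succ'] at hsum
    refine hsum.congr fun n => ?_
    have hn : (0 : ℝ) < (n : ℝ) + 1 := by positivity
    rw [bernsteinMoment_succ_succ, Finset.sum_range_succ, Nat.choose_self]
    push_cast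
    simp_rw [← mul_div_assoc]
    rw [← Finset.sum_div]
    field_simp
    ring

/-- The Bernstein operators, evaluated at a real point `x` outside of `[0, 1]`, approximate entire
functions, with an error controlled by the maximum of the function on a fixed circle. -/
theorem exists_bernstein_error (x : ℝ) : ∃ e : ℕ → ℝ, Tendsto e atTop (𝓝 0) ∧
    ∀ h : ℂ → ℂ, Differentiable ℂ h → ∀ C : ℝ,
      (∀ z ∈ Metric.sphere (0 : ℂ) (2 * max 1 |x|), ‖h z‖ ≤ C) → ∀ n : ℕ,
      ‖∑ ν ∈ Finset.range (n + 1), ((n.choose ν : ℝ) * x ^ (n - ν) * (1 - x) ^ ν : ℝ) *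
        h (((n - ν : ℕ) : ℂ) / n) - h x‖ ≤ C * e n := by
  set r := max 1 |x| with hr
  have hr0 : 0 < r := lt_of_lt_of_le one_pos (le_max_left _ _)
  have hbound : ∀ n m : ℕ, ‖|bernsteinMoment x n m / n ^ m - x ^ m| / (2 * r) ^ m‖ ≤
      2 * (1 / 2) ^ m := by
    intro n m
    rw [Real.norm_of_nonneg (by positivity), div_le_iff₀ (by positivity)]
    have h1 : |x ^ m| ≤ r ^ m := by rw [abs_pow]; gcongr; exact le_max_right _ _
    have h2 := abs_sub (bernsteinMoment x n m / n ^ m) (x ^ m)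
    have h3 := abs_bernsteinMoment_div_le x n m
    have h4 : 2 * (1 / 2 : ℝ) ^ m * (2 * r) ^ m = 2 * r ^ m := by
      rw [mul_assoc, ← mul_pow]; ring_nf
    linarith
  have hgeom : Summable fun m : ℕ => 2 * (1 / 2 : ℝ) ^ m := summable_geometric_two.mul_left 2
  refine ⟨fun n => ∑' m : ℕ, |bernsteinMoment x n m / n ^ m - x ^ m| / (2 * r) ^ m, ?_, ?_⟩
  · have h := tendsto_tsum_of_dominated_convergence (𝓕 := atTop) (g := fun _ : ℕ => (0 : ℝ))
      (f := fun n m : ℕ => |bernsteinMoment x n m / n ^ m - x ^ m| / (2 * r) ^ m) hgeom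
      (fun m => ?_) (Eventually.of_forall fun n m => hbound n m)
    · simpa using h
    · have h1 := (((tendsto_bernsteinMoment x m).sub_const (x ^ m)).abs).div_const ((2 * r) ^ m)
      simpa using h1
  · intro h hh C hC n
    -- Taylor coefficients at `0`; Cauchy's estimate on the circle of radius `2r` beats `r ^ m`.
    set a : ℕ → ℂ := fun m => (m.factorial : ℂ)⁻¹ * iteratedDeriv m h 0 with ha
    have hsum : ∀ z : ℂ, HasSum (fun m => a m * z ^ m) (h z) := fun z => by
      refine (Complex.hasSum_taylorSeries_of_entire hh 0 z).congr_fun fun m => ?_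
      rw [ha, sub_zero, smul_eq_mul, smul_eq_mul]; ring
    have hab : ∀ m, ‖a m‖ ≤ C / (2 * r) ^ m := fun m => by
      have h1 := Complex.norm_iteratedDeriv_le_of_forall_mem_sphere_norm_le m
        (by positivity : 0 < 2 * r) hh.diffContOnCl hC
      have h2 : (0 : ℝ) < m.factorial := by exact_mod_cast m.factorial_pos
      rw [ha, norm_mul, norm_inv, Complex.norm_natCast, inv_mul_le_iff₀ h2, ← mul_div_assoc]
      exact h1
    have h1 : HasSum (fun m => a m * ((bernsteinMoment x n m / n ^ m - x ^ m : ℝ) : ℂ))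
        (∑ ν ∈ Finset.range (n + 1), ((n.choose ν : ℝ) * x ^ (n - ν) * (1 - x) ^ ν : ℝ) *
          h (((n - ν : ℕ) : ℂ) / n) - h x) := by
      refine ((hasSum_sum fun ν (_ : ν ∈ Finset.range (n + 1)) =>
        (hsum (((n - ν : ℕ) : ℂ) / n)).mul_left
          (((n.choose ν : ℝ) * x ^ (n - ν) * (1 - x) ^ ν : ℝ) : ℂ)).sub (hsum x)).congr_fun
        fun m => ?_
      rw [bernsteinMoment]
      push_cast
      rw [mul_sub, Finset.sum_div, Finset.mul_sum]
      congr 1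
      refine Finset.sum_congr rfl fun ν _ => ?_
      rw [div_pow]; ring
    have h2 : Summable fun m : ℕ => |bernsteinMoment x n m / n ^ m - x ^ m| / (2 * r) ^ m :=
      hgeom.of_norm_bounded (hbound n)
    rw [← h1.tsum_eq]
    refine tsum_of_norm_bounded (h2.hasSum.mul_left C) fun m => ?_
    rw [norm_mul, Complex.norm_real, Real.norm_eq_abs, mul_div_assoc', mul_div_right_comm]
    gcongr
    exact hab m

/-! ### Weighted convergence and the topology of `𝓓'` -/

theorem integrable_mul_testFunction {W : ℝ × ℝ → ℝ} (hW : Continuous W)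
    (u : 𝓓((⊤ : TopologicalSpace.Opens (ℝ × ℝ)), ℝ)) :
    Integrable (fun p => W p * u p) halfMeasure := by
  have := isLocallyFiniteMeasure_halfMeasure
  exact (hW.mul u.continuous).integrable_of_hasCompactSupport u.hasCompactSupport.mul_left

open TopologicalSpace in
/-- Multiplication by a continuous weight, from test functions to `L¹` of the half-plane. -/
noncomputable def mulToL1 {W : ℝ × ℝ → ℝ} (hW : Continuous W) :
    𝓓((⊤ : Opens (ℝ × ℝ)), ℝ) →L[ℝ] (ℝ × ℝ →₁[halfMeasure] ℝ) :=
  TestFunction.mkCLM ℝ (fun u => (integrable_mul_testFunction hW u).toL1)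
    (fun u v => by
      rw [← Integrable.toL1_add]
      congr 1; ext p; simp [mul_add])
    (fun c u => by
      rw [← Integrable.toL1_smul]
      congr 1; ext p; simp [mul_left_comm])
    (fun K hK => by
      have := isLocallyFiniteMeasure_halfMeasure
      have hWK : IntegrableOn W K halfMeasure := hW.continuousOn.integrableOn_compact K.isCompact
      refine (ContDiffMapSupportedIn.mkCLMtoNormedSpace ℝ (n := ⊤) (K := K)
        (fun u => (integrable_mul_testFunction hW (TestFunction.ofSupportedIn hK u)).toL1)
        ?_ ?_ ⟨{0}, ∫ p in K, ‖W p‖ ∂halfMeasure, by positivity, ?_⟩).continuous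
      · intro u v
        rw [← Integrable.toL1_add]
        congr 1; ext p; simp [mul_add]
      · intro c u
        rw [← Integrable.toL1_smul]
        congr 1; ext p; simp [mul_left_comm]
      · intro u
        rw [L1.norm_of_fun_eq_integral_norm, Finset.sup_singleton,
          ← setIntegral_eq_integral_of_forall_compl_eq_zero (s := K), ← integral_mul_const]
        · refine integral_mono_of_nonneg (Eventually.of_forall fun p => norm_nonneg _)
            (hWK.norm.mul_const _) (Eventually.of_forall fun p => ?_)
          simp only [norm_mul]
          gcongr
          exact ContDiffMapSupportedIn.norm_apply_le_seminorm ℝ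
        · intro p hp
          have : u p = 0 := u.zero_on_compl hp
          simp [this])

theorem norm_mulToL1 {W : ℝ × ℝ → ℝ} (hW : Continuous W)
    (u : 𝓓((⊤ : TopologicalSpace.Opens (ℝ × ℝ)), ℝ)) :
    ‖mulToL1 hW u‖ = ∫ p, ‖W p * u p‖ ∂halfMeasure :=
  L1.norm_of_fun_eq_integral_norm (integrable_mul_testFunction hW u)

/-- The topology of `𝓓'` is that of uniform convergence on compact sets of test functions, on which
the continuous seminorm `u ↦ ∫ |W u|` is bounded. -/
theorem tendsto_distribution_of_weighted_bound
    {T : ℕ → 𝓓'((⊤ : TopologicalSpace.Opens (ℝ × ℝ)), ℂ)}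
    {T₀ : 𝓓'((⊤ : TopologicalSpace.Opens (ℝ × ℝ)), ℂ)} {W : ℝ × ℝ → ℝ} (hW : Continuous W)
    {e : ℕ → ℝ} (he : Tendsto e atTop (𝓝 0))
    (hT : ∀ᶠ n in atTop, ∀ u, ‖T n u - T₀ u‖ ≤ e n * ∫ p, ‖W p * u p‖ ∂halfMeasure) :
    Tendsto T atTop (𝓝 T₀) := by
  refine (UniformConvergenceCLM.tendsto_iff_tendstoUniformlyOn _ _ _).mpr fun s hs => ?_
  have hs : IsCompact s := hs
  obtain ⟨B, hB⟩ := hs.exists_bound_of_continuousOn (mulToL1 hW).continuous.continuousOn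
  rw [Metric.tendstoUniformlyOn_iff]
  intro ε hε
  have h1 : Tendsto (fun n => |e n| * B) atTop (𝓝 0) := by simpa using he.abs.mul_const B
  filter_upwards [hT, h1.eventually_lt_const hε] with n hn hn2 u hu
  rw [dist_comm, dist_eq_norm]
  refine (hn u).trans_lt (lt_of_le_of_lt ?_ hn2)
  rw [← norm_mulToL1 hW]
  have := hB u hu
  exact mul_le_mul (le_abs_self _) this (norm_nonneg _) (abs_nonneg _)

/-! ### The supershift -/

theorem integrable_continuous_mul_testFunction {f : ℝ × ℝ → ℂ} (hf : Continuous f)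
    (u : 𝓓((⊤ : TopologicalSpace.Opens (ℝ × ℝ)), ℝ)) :
    Integrable (fun p => f p * (u p : ℂ)) halfMeasure := by
  have := isLocallyFiniteMeasure_halfMeasure
  exact (hf.mul (Complex.continuous_ofReal.comp u.continuous)).integrable_of_hasCompactSupport
    (u.hasCompactSupport.comp_left Complex.ofReal_zero).mul_left

theorem sum_smul_halfDist_apply {ι : Type*} (s : Finset ι) (c : ι → ℝ) {F : ι → ℝ × ℝ → ℂ}
    (hF : ∀ i, Continuous (F i)) (u : 𝓓((⊤ : TopologicalSpace.Opens (ℝ × ℝ)), ℝ)) :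
    (∑ i ∈ s, c i • halfDist (F i)) u =
      ∫ p, (∑ i ∈ s, (c i : ℂ) * F i p) * (u p : ℂ) ∂halfMeasure := by
  have := isLocallyFiniteMeasure_halfMeasure
  have h1 : (∑ i ∈ s, c i • halfDist (F i)) u = ∑ i ∈ s, c i • halfDist (F i) u := by
    simp [sum_apply, smul_apply]
  rw [h1]
  simp_rw [Finset.sum_mul]
  rw [integral_finsetSum]
  · refine Finset.sum_congr rfl fun i _ => ?_
    rw [halfDist_apply (hF i).locallyIntegrable, Complex.real_smul, ← integral_const_mul]
    congr 1; ext p; ring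
  · intro i _
    exact integrable_continuous_mul_testFunction (continuous_const.mul (hF i)) u

/-- The supershift: the superposition of the truncations with frequencies `1 - 2ν/N'` is a Bernstein
operator in the variable `y = (1 + s) / 2`, applied to an entire function of `s` and evaluated at
`(1 + ω) / 2`. -/
theorem tendsto_supershift {f : ℂ → ℝ × ℝ → ℂ} (hf : EntireFamily f) (ω : ℝ) :
    Tendsto (fun N' : ℕ => ∑ ν ∈ Finset.range (N' + 1),
        ((N'.choose ν : ℝ) * ((1 + ω) / 2) ^ (N' - ν) * ((1 - ω) / 2) ^ ν) •
          halfDist (f ((1 - 2 * (ν : ℝ) / (N' : ℝ) : ℝ) : ℂ)))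
      atTop (𝓝 (halfDist (f ω))) := by
  have := isLocallyFiniteMeasure_halfMeasure
  obtain ⟨e, he, hb⟩ := exists_bernstein_error ((1 + ω) / 2)
  set circ := Metric.sphere (0 : ℂ) (2 * max 1 |(1 + ω) / 2|)
  have hc : Continuous (Function.uncurry fun (p : ℝ × ℝ) (y : ℂ) => ‖f (2 * y - 1) p‖) :=
    (hf.1.comp (by fun_prop : Continuous fun q : (ℝ × ℝ) × ℂ => (2 * q.2 - 1, q.1))).norm
  set W : ℝ × ℝ → ℝ := fun p => sSup ((fun y => ‖f (2 * y - 1) p‖) '' circ) with hW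
  have hWc : Continuous W := (isCompact_sphere _ _).continuous_sSup hc
  have hW0 : ∀ p, 0 ≤ W p := fun p =>
    Real.sSup_nonneg (by rintro _ ⟨y, _, rfl⟩; exact norm_nonneg _)
  have hWle : ∀ p, ∀ y ∈ circ, ‖f (2 * y - 1) p‖ ≤ W p := fun p y hy =>
    le_csSup ((isCompact_sphere _ _).bddAbove_image
      (hc.comp (Continuous.prodMk_right p)).continuousOn) ⟨y, hy, rfl⟩
  refine tendsto_distribution_of_weighted_bound hWc he ?_
  filter_upwards [eventually_gt_atTop 0] with n hn u
  have hn' : (n : ℂ) ≠ 0 := by exact_mod_cast hn.ne'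
  have hsc : Continuous fun p => ∑ ν ∈ Finset.range (n + 1),
      (((n.choose ν : ℝ) * ((1 + ω) / 2) ^ (n - ν) * ((1 - ω) / 2) ^ ν : ℝ) : ℂ) *
        f ((1 - 2 * (ν : ℝ) / (n : ℝ) : ℝ) : ℂ) p :=
    continuous_finsetSum _ fun ν _ => continuous_const.mul (hf.continuous_right _)
  rw [sum_smul_halfDist_apply _ _ (fun ν => hf.continuous_right _),
    halfDist_apply (hf.continuous_right _).locallyIntegrable, ← integral_sub
      (integrable_continuous_mul_testFunction hsc u)
      (integrable_continuous_mul_testFunction (hf.continuous_right _) u), ← integral_const_mul]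
  refine norm_integral_le_of_norm_le
    ((integrable_mul_testFunction hWc u).norm.const_mul (e n)) (Eventually.of_forall fun p => ?_)
  rw [← sub_mul, norm_mul, norm_mul, Complex.norm_real, Real.norm_of_nonneg (hW0 p), ← mul_assoc,
    mul_comm (e n)]
  gcongr
  have h := hb (fun y => f (2 * y - 1) p)
    ((hf.2 p).comp (by fun_prop : Differentiable ℂ fun y : ℂ => 2 * y - 1)) (W p) (hWle p) n
  refine le_of_eq_of_le ?_ h
  congr 2
  · refine Finset.sum_congr rfl fun ν hν => ?_
    have hν' : ν ≤ n := by rw [Finset.mem_range] at hν; omega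
    congr 2
    · rw [show 1 - (1 + ω) / 2 = (1 - ω) / 2 by ring]
    · rw [Nat.cast_sub hν']
      push_cast
      field_simp
      ring
  · push_cast
    ring_nf

end PeriodicSchrodinger

theorem theorem4p4 (α : ℝ) (hα : α = 1 ∨ α = -1) (V : ℝ → ℝ) (hV : ContDiff ℝ ((⊤ : ℕ∞) : WithTop ℕ∞) V)
    (hper : Function.Periodic V (2 * Real.pi)) (ω : ℝ) :
    -- the objects are well defined
    ((∀ t : ℝ, 0 ≤ t → ExpConverges (intFullMatrix V α ω t)) ∧
      LocallyIntegrable (phi V α ω) halfMeasure ∧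
      (∀ (K M N : ℕ) (s : ℝ), LocallyIntegrable (phiTrunc V α K M N s) halfMeasure) ∧
      IsTemperedInX (halfDist (phi V α ω)) ∧
      ∀ (K M N : ℕ) (s : ℝ), IsTemperedInX (halfDist (phiTrunc V α K M N s))) ∧
    -- convergence of the truncations, tested against functions which are Schwartz in `x`
    (∀ g : 𝓢(ℝ × ℝ, ℂ), HasBoundedTimeSupport g →
      Integrable (fun p => phi V α ω p * g p) halfMeasure ∧
      (∀ K M N : ℕ, Integrable (fun p => phiTrunc V α K M N ω p * g p) halfMeasure) ∧
      Tendsto (fun i : ℕ × ℕ × ℕ => ∫ p, phiTrunc V α i.1 i.2.1 i.2.2 ω p * g p ∂halfMeasure)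
        (atTop ×ˢ atTop ×ˢ atTop) (𝓝 (∫ p, phi V α ω p * g p ∂halfMeasure))) ∧
    -- convergence of the truncations as distributions on `ℝ⁺ × 𝕊¹`
    TendstoOnCylinder (fun i : ℕ × ℕ × ℕ => halfDist (phiTrunc V α i.1 i.2.1 i.2.2 ω))
      (atTop ×ˢ atTop ×ˢ atTop) (halfDist (phi V α ω)) ∧
    -- approximate supershift, in the space of distributions
    ∀ K M N : ℕ,
      Tendsto (fun N' : ℕ => ∑ ν ∈ Finset.range (N' + 1),
          ((N'.choose ν : ℝ) * ((1 + ω) / 2) ^ (N' - ν) * ((1 - ω) / 2) ^ ν) •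
            halfDist (phiTrunc V α K M N (1 - 2 * (ν : ℝ) / (N' : ℝ))))
        atTop (𝓝 (halfDist (phiTrunc V α K M N ω))) := by
  have hsum := summable_norm_potCoeff (contDiff_infty.mp hV 2) hper
  have hS : 0 ≤ ∑' k, ‖potCoeff V k‖ := tsum_nonneg fun k => norm_nonneg _
  have hphi := hasTimeGrowth_phi hsum α ω
  have htrunc := hasTimeGrowth_phiTrunc hsum α
  refine ⟨⟨fun t _ => ?_, hphi.locallyIntegrable,
    fun K M N s => (htrunc K M N s).locallyIntegrable,
    ⟨cylExtension hS hphi, cylExtension_extends hS hphi⟩,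
    fun K M N s => ⟨cylExtension hS (htrunc K M N s), cylExtension_extends hS _⟩⟩,
    fun g hg => ⟨hphi.integrable_mul_schwartz hS hg,
      fun K M N => (htrunc K M N ω).integrable_mul_schwartz hS hg,
      tendsto_integral_mul_schwartz hS (fun i : ℕ × ℕ × ℕ => htrunc i.1 i.2.1 i.2.2 ω)
        (tendsto_phiTrunc hsum α ω) hg⟩,
    tendstoOnCylinder_of_hasTimeGrowth hS (fun i : ℕ × ℕ × ℕ => htrunc i.1 i.2.1 i.2.2 ω) hphi
      (tendsto_phiTrunc hsum α ω), fun K M N => ?_⟩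
  · rw [intFullMatrix_eq]
    exact expConverges_of_norm_le (fun k => by positivity) (hsum.mul_left |t|)
      (norm_freqMatrix_le V α ω t)
  · have h := tendsto_supershift (entireFamily_phiTruncC V α K M N) ω
    simp only [phiTruncC_ofReal] at h
    exact h
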